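/- Work over $\mathbb{C}[\mathbf t]$, $\mathbf t=(t_1,t_2,\dots)$. For $\rho\in\mathbb{C}$ put $$J(z;\rho)=\sum_{n\ge1}(1-\rho^n)\,n\,t_n z^{n-1}+\sum_{n\ge1}\frac{\partial}{\partial t_n}z^{-n-1},$$ and, for integers $k\ge1$, define operators $P^{(k)}_m(\rho)$ $(m\in\mathbb{Z})$ on $\mathbb{C}[\mathbf t]$ by $$\sum_{m\in\mathbb{Z}}P^{(k)}_m(\rho)\,z^{-m-k}=\; :\bigl(\partial_z+J(z;\rho)\bigr)^{k-1}J(z;\rho):,$$ where $:\ :$ is the normal ordering, which moves all derivations $\partial/\partial t_n$ to the right of all multiplications by $t_n$. Define vertex operators $B_n$ $(n\in\mathbb{Z})$ on $\mathbb{C}[\mathbf t]$ by $$\sum_{n\in\mathbb{Z}}B_nz^n=\exp\Bigl(\sum_{n\ge1}(1-\rho^n)t_nz^n\Bigr)\exp\Bigl(-\sum_{n\ge1}\frac1n\frac{\partial}{\partial t_n}z^{-n}\Bigr).$$ Set $\rho=-1$, write $P^{(k)}_m=P^{(k)}_m(-1)$, and for $\lambda=(\lambda_1,\dots,\lambda_l)\in\mathbb{Z}^l$,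 $l\ge0$, let $Q_\lambda=B_{\lambda_1}\cdots B_{\lambda_l}\cdot1\in\mathbb{C}[\mathbf t]$ be the Schur $Q$-function. **Theorem 1.1.** For all integers $k\ge1$ and $m$, all $l\ge0$ and all $\lambda=(\lambda_1,\dots,\lambda_l)\in\mathbb{Z}^l$, $$P^{(k)}_m\cdot Q_\lambda=\sum_{i=1}^{l}c_k^m(\lambda_i)\,Q_{\lambda-m\epsilon_i}+\delta_{m<0}\sum_{a=0}^{-m}(-1)^{m-a}d_k(a)\,Q_{(\lambda,a,-m-a)}.$$ Here $\lambda-m\epsilon_i=(\lambda_1,\dots,\lambda_i-m,\dots,\lambda_l)$, $(\lambda,a,b)=(\lambda_1,\dots,\lambda_l,a,b)$, $\delta_{m<0}$ is $1$ if $m<0$ and $0$ otherwise, and for every integer $n$ $$d_k(n)=k!\,\frac{(-1)^{k-1}}{2^k}\sum_{j=0}^{k-1}(-2)^j\binom nj,\qquad c_k^m(n)=2d_k(n-m)-2(-1)^m d_k(-n),$$ with $\binom nj=\frac{1}{j!}\prod_{i=0}^{j-1}(n-i)$ for all integers $n$ (possibly negative). -/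

import Mathlib

open scoped LaurentPolynomial

noncomputable section

namespace WTypeQ

/-- The polynomial ring `ℂ[𝐭]` in the variables `𝐭 = (t₁, t₂, …)`. -/
abbrev Poly : Type := MvPolynomial ℕ+ ℂ

/-- The operator `∂/∂tₙ` on `ℂ[𝐭]`. -/
abbrev partialT (n : ℕ+) : Module.End ℂ Poly := (MvPolynomial.pderiv n).toLinearMap

theorem partialT_commute (m n : ℕ+) : Commute (partialT m) (partialT n) := by
  have h : ⁅(MvPolynomial.pderiv m : Derivation ℂ Poly Poly),
      (MvPolynomial.pderiv n : Derivation ℂ Poly Poly)⁆ = 0 := by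
    apply MvPolynomial.derivation_ext
    intro i
    simp only [Derivation.commutator_apply, MvPolynomial.pderiv_X, Derivation.coe_zero,
      Pi.zero_apply]
    rw [Pi.single_apply, Pi.single_apply]
    split_ifs <;> simp
  refine LinearMap.ext fun f => ?_
  have h2 := congrArg (fun D : Derivation ℂ Poly Poly => D f) h
  simpa [Derivation.commutator_apply, sub_eq_zero] using h2

/-- The iterated derivative `∂^β = ∏ₙ (∂/∂tₙ)^{βₙ}`. -/
def partialPow (β : ℕ+ →₀ ℕ) : Module.End ℂ Poly :=
  β.support.noncommProd (fun n => partialT n ^ β n)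
    (fun m _ n _ _ => (partialT_commute m n).pow_pow (β m) (β n))

/-! ### Normal ordering

Inside `: :` all `tₙ` and `∂/∂tₙ` commute.  An expression inside the colons is therefore a formal
power series in commuting letters `tₙ` (`Sum.inl n`) and `∂/∂tₙ` (`Sum.inr n`); its coefficients
here are Laurent polynomials in `z`.  The normal ordering replaces each monomial of the series by
the operator in which the multiplications `tₙ` stand to the left of the derivations. -/

/-- Commutative expressions in the letters `tₙ`, `∂/∂tₙ`, with coefficients in `ℂ[z, z⁻¹]`. -/
abbrev Symb : Type := MvPowerSeries (ℕ+ ⊕ ℕ+) ℂ[T;T⁻¹]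

/-- The operator that is the coefficient of `z ^ j` in `:F(z):`, namely
`∑_{α, β} (coefficient of t^α ∂^β z^j in F) · t^α ∂^β`.  (For the series used below only finitely
many terms of the sum act nontrivially on a given polynomial.) -/
def normalOrderCoeff (F : Symb) (j : ℤ) (f : Poly) : Poly :=
  ∑ᶠ p : (ℕ+ →₀ ℕ) × (ℕ+ →₀ ℕ),
    (MvPowerSeries.coeff (Finsupp.sumElim p.1 p.2) F).coeff j •
      (MvPolynomial.monomial p.1 (1 : ℂ) * partialPow p.2 f)

/-- `d/dz` on Laurent polynomials. -/
def laurentDeriv (p : ℂ[T;T⁻¹]) : ℂ[T;T⁻¹] :=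
  p.coeff.sum fun n a => LaurentPolynomial.C ((n : ℂ) * a) * LaurentPolynomial.T (n - 1)

/-- `∂_z` on expressions, applied to the coefficients. -/
def dz (F : Symb) : Symb := fun e => laurentDeriv (MvPowerSeries.coeff e F)

/-- The linear expression `∑ₛ c(s) · s` in the letters `s`. -/
def linearSymb (c : ℕ+ ⊕ ℕ+ → ℂ[T;T⁻¹]) : Symb :=
  fun e => if e.degree = 1 then ∑ s ∈ e.support, c s else 0

/-- `J(z; ρ) = ∑_{n ≥ 1} (1 - ρⁿ) n tₙ z^{n-1} + ∑_{n ≥ 1} ∂/∂tₙ z^{-n-1}`. -/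
def J (ρ : ℂ) : Symb :=
  linearSymb (Sum.elim
    (fun n : ℕ+ => LaurentPolynomial.C ((1 - ρ ^ (n : ℕ)) * (n : ℕ)) *
      LaurentPolynomial.T (((n : ℕ) : ℤ) - 1))
    (fun n : ℕ+ => LaurentPolynomial.T (-((n : ℕ) : ℤ) - 1)))

/-- The expression `(∂_z + J(z; ρ))^{k-1} J(z; ρ)`, for `k ≥ 1`. -/
def PSymb (ρ : ℂ) (k : ℕ) : Symb := (fun F => dz F + J ρ * F)^[k - 1] (J ρ)

/-- The operator `P^{(k)}_m(ρ)` on `ℂ[𝐭]`, for `k ≥ 1` and `m ∈ ℤ`: the coefficient of `z^{-m-k}`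
in `P^{(k)}(z; ρ) = :(∂_z + J(z; ρ))^{k-1} J(z; ρ):`. -/
def P (ρ : ℂ) (k : ℕ) (m : ℤ) : Poly → Poly := normalOrderCoeff (PSymb ρ k) (-m - (k : ℤ))

/-! ### Vertex operators and Q-functions -/

/-- The exponential `∑ⱼ Aʲ / j!` of a power series `A` without constant term, over an algebra that
need not be commutative (in the coefficient of `zⁿ` the terms with `j > n` vanish). -/
def expSeries {R : Type*} [Ring R] [Algebra ℂ R] (A : PowerSeries R) : PowerSeries R :=
  PowerSeries.mk fun n =>
    ∑ j ∈ Finset.range (n + 1), ((j.factorial : ℂ)⁻¹) • PowerSeries.coeff n (A ^ j)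

/-- `exp(∑_{n ≥ 1} (1 - ρⁿ) tₙ zⁿ)`, a power series in `z` over `ℂ[𝐭]`. -/
def vertexPlus (ρ : ℂ) : PowerSeries Poly :=
  expSeries (PowerSeries.mk fun n =>
    if h : 0 < n then (1 - ρ ^ n) • MvPolynomial.X (⟨n, h⟩ : ℕ+) else 0)

/-- `exp(-∑_{n ≥ 1} (1/n) ∂/∂tₙ wⁿ)`, a power series in `w = z⁻¹` over the operators on `ℂ[𝐭]`. -/
def vertexMinus : PowerSeries (Module.End ℂ Poly) :=
  expSeries (PowerSeries.mk fun n =>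
    if h : 0 < n then -((n : ℂ)⁻¹ • partialT ⟨n, h⟩) else 0)

/-- The vertex operator `Bₙ`, `n ∈ ℤ`: the coefficient of `zⁿ` in
`B(z) = exp(∑ (1 - ρⁿ) tₙ zⁿ) exp(-∑ (1/n) ∂/∂tₙ z^{-n})`.  (Only finitely many terms of the sum are
nonzero, as the `q`-th coefficient of the second factor lowers the degree by `q`, where
`deg tₙ = n`.) -/
def B (ρ : ℂ) (n : ℤ) (f : Poly) : Poly :=
  ∑ᶠ q : ℕ, if 0 ≤ n + (q : ℤ) then
    PowerSeries.coeff (n + (q : ℤ)).toNat (vertexPlus ρ) * PowerSeries.coeff q vertexMinus f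
  else 0

/-- The Hall–Littlewood function `H_λ(𝐭; ρ) = B_{λ₁} ⋯ B_{λ_l} · 1`, for `λ ∈ ℤ^l`. -/
def hallLittlewood (ρ : ℂ) {l : ℕ} (lam : Fin l → ℤ) : Poly :=
  (List.ofFn lam).foldr (B ρ) 1

/-- The Schur Q-function `Q_λ(𝐭) = H_λ(𝐭; -1)`. -/
def schurQ {l : ℕ} (lam : Fin l → ℤ) : Poly := hallLittlewood (-1) lam

/-! ### Coefficients -/

/-- `binom(n, j) = n (n - 1) ⋯ (n - j + 1) / j!`, for an integer `n`, possibly negative. -/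
def intBinom (n : ℤ) (j : ℕ) : ℂ :=
  (∏ i ∈ Finset.range j, ((n : ℂ) - (i : ℂ))) / (j.factorial : ℂ)

/-- `d_k(n) = k! (-1)^{k-1} 2^{-k} ∑_{j=0}^{k-1} (-2)^j binom(n, j)`, for `k ≥ 1`. -/
def dCoeff (k : ℕ) (n : ℤ) : ℂ :=
  (k.factorial : ℂ) * ((-1) ^ (k - 1) / 2 ^ k) *
    ∑ j ∈ Finset.range k, (-2) ^ j * intBinom n j

/-- `c_k^m(n) = 2 d_k(n - m) - 2 (-1)^m d_k(-n)`. -/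
def cCoeff (k : ℕ) (m n : ℤ) : ℂ :=
  2 * dCoeff k (n - m) - 2 * (-1) ^ m * dCoeff k (-n)

end WTypeQ

end

/-! At ρ = -1 the modes B_n act as neutral fermions on the polynomials in the odd-indexed variables,
and there every P^{(k)}_m is quadratic in them. The formula is the commutator of this quadratic
expression with a product of fermions, plus its value on the vacuum 1.

Clifford relations: moving the derivations of B(x) past the multiplications of B(y) gives B(x)B(y) =
c(y/x) :B(x)B(y): with c(u) = (1-u)/(1+u) expanded at u = 0 (`vertexOp_vertexOp`). The sum c(u) +
c(1/u) = 2 ∑ (-u)^j is a delta function at y = -x, and there the normally ordered product is the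
identity on odd polynomials, because the exponents are odd in x (`alternating_sum_normalOp`). This
yields `vertexOp_anticommute`.

Bosonization: J is the logarithmic derivative of B, so ∂_w^k :B(w)B(-z): at w = z equals :(∂_z +
J)^k · 1: on odd polynomials (`symbOp_eq_fermionSum`). The resulting coefficients are the descending
factorials j(j-1)⋯(j-k+1) of the products :B_j B_{-m-j}:. Passing to ordinary products minus their
vacuum expectation values inverts a first-order difference equation, whose solution is d_k
(`dCoeff_add`, `sum_dCoeff_vac`). So P^{(k)}_m = ∑_a d_k(a) ((-1)^{m+a} B_a B_{-m-a} - vacuum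
value), which is `P_eq_sum_vertexOp`.

From [XY, Z] = X{Y, Z} - {X, Z}Y one gets [P^{(k)}_m, B_n] = c_k^m(n) B_{n-m} (`P_vertexOp`); since
B_n · 1 = 0 for n < 0, only 0 ≤ a ≤ -m survives on the vacuum (`P_one`). Induction on the length of
λ finishes the proof. -/

noncomputable section

namespace WTypeQ

/-! ### Exponentials of power series and their Euler equation -/

section ExpSeries

variable {R : Type*} [Ring R]

theorem coeff_pow_eq_zero {A : PowerSeries R} (h0 : PowerSeries.coeff 0 A = 0) (j n : ℕ)
    (hn : n < j) : PowerSeries.coeff n (A ^ j) = 0 := by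
  induction j generalizing n with
  | zero => omega
  | succ j ih =>
    rw [pow_succ, PowerSeries.coeff_mul]
    refine Finset.sum_eq_zero fun p hp => ?_
    have hp := Finset.HasAntidiagonal.mem_antidiagonal.mp hp
    rcases Nat.eq_zero_or_pos p.2 with h | h
    · rw [h, h0, mul_zero]
    · rw [ih _ (by omega), zero_mul]

/-- The coefficients of a power series, indexed by the integers. -/
def zcoeff (F : PowerSeries R) (n : ℤ) : R := if 0 ≤ n then PowerSeries.coeff n.toNat F else 0

theorem zcoeff_of_neg (F : PowerSeries R) {n : ℤ} (hn : n < 0) : zcoeff F n = 0 := by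
  rw [zcoeff, if_neg (by omega)]

theorem zcoeff_natCast (F : PowerSeries R) (n : ℕ) :
    zcoeff F (n : ℤ) = PowerSeries.coeff n F := by
  simp [zcoeff]

variable [Algebra ℂ R]

/-- The Euler operator `x d/dx` on power series. -/
def euler (F : PowerSeries R) : PowerSeries R :=
  PowerSeries.mk fun n => (n : ℂ) • PowerSeries.coeff n F

theorem coeff_euler (F : PowerSeries R) (n : ℕ) :
    PowerSeries.coeff n (euler F) = (n : ℂ) • PowerSeries.coeff n F := by
  simp [euler]

theorem euler_mul (F G : PowerSeries R) : euler (F * G) = euler F * G + F * euler G := by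
  ext n
  simp only [coeff_euler, PowerSeries.coeff_mul, map_add, Finset.smul_sum,
    ← Finset.sum_add_distrib]
  refine Finset.sum_congr rfl fun p hp => ?_
  rw [← Finset.HasAntidiagonal.mem_antidiagonal.mp hp]
  simp only [smul_mul_assoc, mul_smul_comm, ← add_smul, Nat.cast_add]

theorem commute_euler {A : PowerSeries R}
    (hA : ∀ i j, Commute (PowerSeries.coeff i A) (PowerSeries.coeff j A)) :
    Commute (euler A) A := by
  ext n
  simp only [PowerSeries.coeff_mul, coeff_euler]
  rw [← Finset.Nat.sum_antidiagonal_swap]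
  refine Finset.sum_congr rfl fun p _ => ?_
  simp only [Prod.fst_swap, Prod.snd_swap, smul_mul_assoc, mul_smul_comm, (hA p.1 p.2).eq]

theorem euler_pow_succ {A : PowerSeries R}
    (hA : ∀ i j, Commute (PowerSeries.coeff i A) (PowerSeries.coeff j A)) (j : ℕ) :
    euler (A ^ (j + 1)) = ((j : ℂ) + 1) • (euler A * A ^ j) := by
  induction j with
  | zero => simp
  | succ j ih =>
    rw [pow_succ, euler_mul, ih, ((commute_euler hA).symm.pow_left (j + 1)).eq, smul_mul_assoc,
      mul_assoc, ← pow_succ]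
    push_cast
    rw [add_smul (_ + _) (1 : ℂ), one_smul]

theorem coeff_expSeries {A : PowerSeries R} (h0 : PowerSeries.coeff 0 A = 0) (n N : ℕ)
    (hn : n < N) : PowerSeries.coeff n (expSeries A) =
      ∑ j ∈ Finset.range N, ((j.factorial : ℂ)⁻¹) • PowerSeries.coeff n (A ^ j) := by
  rw [expSeries, PowerSeries.coeff_mk]
  refine Finset.sum_subset (Finset.range_mono (by omega)) fun j _ hj => ?_
  rw [coeff_pow_eq_zero h0 _ _ (by simpa using hj), smul_zero]

theorem coeff_zero_expSeries (A : PowerSeries R) : PowerSeries.coeff 0 (expSeries A) = 1 := by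
  simp [expSeries]

/-- Coefficientwise form of x d/dx exp A = (x A′) exp A. This recursion replaces the definition of
the exponential from here on; commuting coefficients of A make it valid over operators. -/
theorem smul_coeff_expSeries {A : PowerSeries R} (h0 : PowerSeries.coeff 0 A = 0)
    (hA : ∀ i j, Commute (PowerSeries.coeff i A) (PowerSeries.coeff j A)) (n : ℕ) :
    (n : ℂ) • PowerSeries.coeff n (expSeries A) =
      ∑ p ∈ Finset.HasAntidiagonal.antidiagonal n,
        ((p.1 : ℂ) • PowerSeries.coeff p.1 A) * PowerSeries.coeff p.2 (expSeries A) := by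
  have h1 : ∀ p ∈ Finset.HasAntidiagonal.antidiagonal n,
      ((p.1 : ℂ) • PowerSeries.coeff p.1 A) * PowerSeries.coeff p.2 (expSeries A) =
      ∑ j ∈ Finset.range (n + 1), ((j.factorial : ℂ)⁻¹) •
        (PowerSeries.coeff p.1 (euler A) * PowerSeries.coeff p.2 (A ^ j)) := by
    intro p hp
    have hp := Finset.HasAntidiagonal.mem_antidiagonal.mp hp
    rw [coeff_expSeries h0 p.2 (n + 1) (by omega), Finset.mul_sum, coeff_euler]
    simp only [mul_smul_comm]
  rw [Finset.sum_congr rfl h1, Finset.sum_comm, coeff_expSeries h0 n (n + 2) (by omega),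
    Finset.sum_range_succ']
  simp only [← Finset.smul_sum, ← PowerSeries.coeff_mul]
  rw [smul_add, Finset.smul_sum]
  have h2 : (n : ℂ) • (((Nat.factorial 0 : ℕ) : ℂ)⁻¹ • PowerSeries.coeff n (A ^ 0)) = 0 := by
    rcases Nat.eq_zero_or_pos n with h | h
    · simp [h]
    · simp [PowerSeries.coeff_one, h.ne']
  rw [h2, add_zero]
  refine Finset.sum_congr rfl fun j _ => ?_
  rw [smul_comm, ← coeff_euler, euler_pow_succ hA, PowerSeries.coeff_smul, smul_smul]
  congr 1
  rw [Nat.factorial_succ]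
  have : (j.factorial : ℂ) ≠ 0 := by exact_mod_cast j.factorial_ne_zero
  have : (j : ℂ) + 1 ≠ 0 := by exact_mod_cast j.succ_ne_zero
  push_cast
  field_simp

/-- With integer indices the terms beyond n vanish by themselves, so any cutoff L ≥ n is allowed and
one L can serve several recursions at once. -/
theorem smul_zcoeff_expSeries {A : PowerSeries R} (h0 : PowerSeries.coeff 0 A = 0)
    (hA : ∀ i j, Commute (PowerSeries.coeff i A) (PowerSeries.coeff j A)) (n : ℤ) (L : ℕ)
    (hL : n ≤ L) :
    (n : ℂ) • zcoeff (expSeries A) n =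
      ∑ i ∈ Finset.range L, (((i : ℂ) + 1) • PowerSeries.coeff (i + 1) A) *
        zcoeff (expSeries A) (n - (i + 1)) := by
  rcases lt_or_ge n 0 with hn | hn
  · rw [zcoeff_of_neg _ hn, smul_zero]
    refine (Finset.sum_eq_zero fun i _ => ?_).symm
    rw [zcoeff_of_neg _ (by omega), mul_zero]
  · lift n to ℕ using hn
    rw [zcoeff_natCast, Int.cast_natCast, smul_coeff_expSeries h0 hA,
      Finset.Nat.sum_antidiagonal_eq_sum_range_succ_mk, Finset.sum_range_succ', h0]
    simp only [smul_zero, zero_mul, add_zero]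
    have hL' : n ≤ L := by omega
    rw [← Finset.sum_subset (Finset.range_mono hL')]
    · refine Finset.sum_congr rfl fun i hi => ?_
      have hi := Finset.mem_range.mp hi
      have : (n : ℤ) - (i + 1) = ((n - (i + 1) : ℕ) : ℤ) := by omega
      rw [this, zcoeff_natCast]
      push_cast
      rfl
    · intro i _ hi
      have hi : n ≤ i := by simpa using hi
      rw [zcoeff_of_neg _ (by omega), mul_zero]

end ExpSeries

/-- Finite substitute for the translation invariance of a sum over ℤ. -/
theorem sum_range_add_eq {M : Type*} [AddCommMonoid M] (F : ℕ → M) (s J : ℕ)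
    (h1 : ∀ k < s, F k = 0) (h2 : ∀ k, J ≤ k → F k = 0) :
    ∑ i ∈ Finset.range J, F (i + s) = ∑ k ∈ Finset.range J, F k := by
  have h3 : ∑ k ∈ Finset.range J, F k = ∑ k ∈ Finset.range (s + J), F k :=
    Finset.sum_subset (Finset.range_mono (by omega)) fun k _ hk => h2 k (by simpa using hk)
  rw [h3, Finset.sum_range_add, Finset.sum_eq_zero fun k hk => h1 k (Finset.mem_range.mp hk),
    zero_add]
  simp only [add_comm]

/-! ### The coefficients of the two factors of the vertex operator -/

/-- The coefficient of `xⁿ` in `exp(∑ (1 - (-1)ⁿ) tₙ xⁿ)`. -/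
def qfun (n : ℤ) : Poly := zcoeff (vertexPlus (-1)) n

/-- The coefficient of `x^{-n}` in `exp(-∑ (1/n) ∂/∂tₙ x^{-n})`. -/
def shiftOp (n : ℤ) : Module.End ℂ Poly := zcoeff vertexMinus n

/-- The scalar `(1 - (-1)ⁿ) n` in front of `tₙ z^{n-1}` in `J(z; -1)`. -/
def oddWeight (n : ℕ) : ℂ := (1 - (-1) ^ n) * n

theorem qfun_of_neg {n : ℤ} (hn : n < 0) : qfun n = 0 := zcoeff_of_neg _ hn

theorem shiftOp_of_neg {n : ℤ} (hn : n < 0) : shiftOp n = 0 := zcoeff_of_neg _ hn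

theorem qfun_zero : qfun 0 = 1 := by
  have := zcoeff_natCast (vertexPlus (-1)) 0
  rw [Nat.cast_zero] at this
  rw [qfun, this, vertexPlus, coeff_zero_expSeries]

theorem shiftOp_zero : shiftOp 0 = 1 := by
  have := zcoeff_natCast vertexMinus 0
  rw [Nat.cast_zero] at this
  rw [shiftOp, this, vertexMinus, coeff_zero_expSeries]

theorem smul_qfun (n : ℤ) (L : ℕ) (hL : n ≤ L) :
    (n : ℂ) • qfun n = ∑ i ∈ Finset.range L,
      (oddWeight (i + 1) • (MvPolynomial.X i.succPNat : Poly)) * qfun (n - (i + 1)) := by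
  rw [qfun, vertexPlus, smul_zcoeff_expSeries (by simp) (fun _ _ => Commute.all _ _) n L hL]
  refine Finset.sum_congr rfl fun i _ => ?_
  rw [PowerSeries.coeff_mk, dif_pos i.succ_pos]
  change ((i : ℂ) + 1) • ((1 - (-1 : ℂ) ^ (i + 1)) • (MvPolynomial.X i.succPNat : Poly)) *
    qfun (n - (i + 1)) = _
  rw [smul_smul, oddWeight]
  congr 2
  push_cast
  ring

theorem smul_shiftOp (n : ℤ) (L : ℕ) (hL : n ≤ L) :
    (n : ℂ) • shiftOp n = -∑ i ∈ Finset.range L,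
      partialT i.succPNat * shiftOp (n - (i + 1)) := by
  rw [shiftOp, vertexMinus, smul_zcoeff_expSeries (by simp) ?_ n L hL, ← Finset.sum_neg_distrib]
  · refine Finset.sum_congr rfl fun i _ => ?_
    rw [PowerSeries.coeff_mk, dif_pos i.succ_pos]
    change ((i : ℂ) + 1) • (-(((i + 1 : ℕ) : ℂ)⁻¹ • partialT i.succPNat)) * shiftOp (n - (i + 1)) = _
    rw [smul_neg, smul_smul]
    have h : ((i : ℂ) + 1) * ((i + 1 : ℕ) : ℂ)⁻¹ = 1 := by
      have : (i : ℂ) + 1 ≠ 0 := by exact_mod_cast i.succ_ne_zero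
      push_cast
      field_simp
    rw [h, one_smul]
    exact neg_mul (partialT i.succPNat) (shiftOp (n - (i + 1)))
  · intro i j
    simp only [PowerSeries.coeff_mk]
    split_ifs
    · exact ((((partialT_commute _ _).smul_left _).smul_right _).neg_left).neg_right
    all_goals simp

/-- By the recursion `smul_shiftOp`, each `shiftOp q` is a polynomial in the derivations. -/
theorem commute_shiftOp {T : Module.End ℂ Poly} (hT : ∀ n, Commute T (partialT n)) (q : ℤ) :
    Commute T (shiftOp q) := by
  rcases lt_or_ge q 0 with hq | hq
  · simp [shiftOp_of_neg hq]
  · lift q to ℕ using hq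
    induction q using Nat.strong_induction_on with
    | _ q ih =>
      rcases Nat.eq_zero_or_pos q with h | h
      · subst h
        simp [shiftOp_zero]
      · have hq : (q : ℂ) ≠ 0 := by exact_mod_cast h.ne'
        have h1 : shiftOp q = (q : ℂ)⁻¹ • ((((q : ℕ) : ℤ) : ℂ) • shiftOp q) := by
          rw [Int.cast_natCast, smul_smul, inv_mul_cancel₀ hq, one_smul]
        rw [h1, smul_shiftOp q q le_rfl]
        refine Commute.smul_right (Commute.neg_right (Commute.sum_right _ _ _ fun i hi => ?_)) _
        have hi := Finset.mem_range.mp hi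
        refine (hT _).mul_right ?_
        have : (q : ℤ) - (i + 1) = ((q - (i + 1) : ℕ) : ℤ) := by omega
        rw [this]
        exact ih _ (by omega)

theorem partialT_commute_shiftOp (n : ℕ+) (q : ℤ) : Commute (partialT n) (shiftOp q) :=
  commute_shiftOp (fun _ => partialT_commute _ _) q

theorem shiftOp_commute (p q : ℤ) : Commute (shiftOp p) (shiftOp q) :=
  commute_shiftOp (fun n => (partialT_commute_shiftOp n p).symm) q

theorem shiftOp_partialT (n : ℕ+) (q : ℤ) (f : Poly) :
    shiftOp q (partialT n f) = partialT n (shiftOp q f) :=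
  LinearMap.congr_fun (partialT_commute_shiftOp n q).eq.symm f

theorem shiftOp_shiftOp (p q : ℤ) (f : Poly) :
    shiftOp p (shiftOp q f) = shiftOp q (shiftOp p f) :=
  LinearMap.congr_fun (shiftOp_commute p q).eq f

theorem smul_shiftOp_apply (n : ℤ) (L : ℕ) (hL : n ≤ L) (f : Poly) :
    (n : ℂ) • shiftOp n f = -∑ i ∈ Finset.range L,
      shiftOp (n - (i + 1)) (partialT i.succPNat f) := by
  have := LinearMap.congr_fun (smul_shiftOp n L hL) f
  simp only [LinearMap.smul_apply, LinearMap.neg_apply, LinearMap.sum_apply,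
    Module.End.mul_apply] at this
  rw [this]
  simp only [shiftOp_partialT]

theorem partialT_mul (n : ℕ+) (f g : Poly) :
    partialT n (f * g) = partialT n f * g + f * partialT n g := by
  change MvPolynomial.pderiv n (f * g) = MvPolynomial.pderiv n f * g + f * MvPolynomial.pderiv n g
  rw [Derivation.leibniz, smul_eq_mul, smul_eq_mul]
  ring

theorem partialT_X (m n : ℕ+) :
    partialT m (MvPolynomial.X n : Poly) = if n = m then 1 else 0 := by
  change MvPolynomial.pderiv m (MvPolynomial.X n : Poly) = _
  rw [MvPolynomial.pderiv_X, Pi.single_apply]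

/-- Division by a nonzero natural number in an equation between vectors. -/
theorem eq_of_natCast_smul {M : Type*} [AddCommGroup M] [Module ℂ M] {n : ℕ} (hn : 0 < n)
    {x y : M} (h : (n : ℂ) • x = (n : ℂ) • y) : x = y :=
  smul_right_injective M (r := (n : ℂ)) (by exact_mod_cast hn.ne') h

/-- Differentiating the exponential by tₙ multiplies it by (1 - (-1)ⁿ) xⁿ; the index `n` here stands
for the variable with index n + 1. -/
theorem partialT_qfun (n : ℕ) (j : ℤ) :
    partialT n.succPNat (qfun j) = (1 - (-1 : ℂ) ^ (n + 1)) • qfun (j - (n + 1)) := by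
  rcases lt_or_ge j 0 with hj | hj
  · rw [qfun_of_neg hj, qfun_of_neg (by omega), map_zero, smul_zero]
  · lift j to ℕ using hj
    induction j using Nat.strong_induction_on with
    | _ j ih =>
      rcases Nat.eq_zero_or_pos j with h | h
      · subst h
        rw [qfun_of_neg (n := ((0 : ℕ) : ℤ) - (n + 1)) (by omega), Nat.cast_zero, qfun_zero]
        change MvPolynomial.pderiv _ _ = _
        simp
      · refine eq_of_natCast_smul h ?_
        -- The cutoff exceeds n, so the sum contains the term in which the derivation hits its own
        -- variable.
        have e1 := smul_qfun j (max j (n + 1)) (by exact_mod_cast le_max_left _ _)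
        rw [Int.cast_natCast] at e1
        have e2 := smul_qfun ((j : ℤ) - (n + 1)) (max j (n + 1)) (by
          have : j ≤ max j (n + 1) := le_max_left _ _
          omega)
        rw [← map_smul, e1, map_sum]
        have e3 : ∀ i ∈ Finset.range (max j (n + 1)),
            partialT n.succPNat ((oddWeight (i + 1) • (MvPolynomial.X i.succPNat : Poly)) *
              qfun ((j : ℤ) - (i + 1))) =
            (if i = n then oddWeight (n + 1) • qfun ((j : ℤ) - (n + 1)) else 0) +
            (1 - (-1 : ℂ) ^ (n + 1)) • ((oddWeight (i + 1) •
              (MvPolynomial.X i.succPNat : Poly)) * qfun ((j : ℤ) - (n + 1) - (i + 1))) := by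
          intro i _
          rw [partialT_mul, map_smul, partialT_X]
          congr 1
          · by_cases hin : i = n
            · subst hin
              simp
            · have : i.succPNat ≠ n.succPNat := fun h' => hin (Nat.succPNat_injective h')
              simp [hin, this]
          · rcases lt_or_ge j (i + 1) with hji | hji
            · rw [qfun_of_neg (n := (j : ℤ) - (i + 1)) (by omega),
                qfun_of_neg (n := (j : ℤ) - (n + 1) - (i + 1)) (by omega)]
              simp
            · have h5 : (j : ℤ) - (i + 1) = ((j - (i + 1) : ℕ) : ℤ) := by omega
              have h6 : (j : ℤ) - (n + 1) - (i + 1) = ((j - (i + 1) : ℕ) : ℤ) - (n + 1) := by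
                omega
              rw [h5, h6, ih _ (by omega), mul_smul_comm]
        rw [Finset.sum_congr rfl e3, Finset.sum_add_distrib, ← Finset.smul_sum, ← e2,
          Finset.sum_ite_eq' _ n, if_pos (by simp), smul_smul, ← add_smul, smul_smul, oddWeight]
        congr 1
        push_cast
        ring

/-! ### The contraction of two vertex operators -/

/-- The coefficient of `xⁱ` in `(1 - x) / (1 + x)`. -/
def contraction (i : ℤ) : ℂ := if i < 0 then 0 else if i = 0 then 1 else 2 * (-1) ^ i

theorem contraction_of_neg {i : ℤ} (hi : i < 0) : contraction i = 0 := if_pos hi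

theorem contraction_zero : contraction 0 = 1 := by simp [contraction]

theorem contraction_of_pos {i : ℤ} (hi : 0 < i) : contraction i = 2 * (-1) ^ i := by
  rw [contraction, if_neg (by omega), if_neg (by omega)]

/-- With c(x) = (1-x)/(1+x), these are the coefficients of c(x)/(1-x) = 1/(1+x) and of c(-x)/(1-x) =
(1+x)/(1-x)². -/
theorem sum_range_contraction (i : ℕ) :
    ∑ j ∈ Finset.range (i + 1), contraction j = (-1) ^ i ∧
      ∑ j ∈ Finset.range (i + 1), (-1) ^ j * contraction j = 2 * (i : ℂ) + 1 := by
  induction i with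
  | zero => simp [contraction_zero]
  | succ i ih =>
    rw [Finset.sum_range_succ, ih.1, Finset.sum_range_succ, ih.2,
      contraction_of_pos (by exact_mod_cast i.succ_pos), zpow_natCast]
    constructor
    · ring
    · have : ((-1 : ℂ) ^ (i + 1)) * (-1) ^ (i + 1) = 1 := by
        rw [← mul_pow]; norm_num
      linear_combination (2 : ℂ) * this - (by push_cast; ring :
        ((i + 1 : ℕ) : ℂ) = (i : ℂ) + 1) * 2

/-- The differential equation x c′ = -(2x/(1-x²)) c, where 2x/(1-x²) = ∑ (1 - (-1)ⁿ) xⁿ. -/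
theorem mul_contraction (i J : ℕ) (hi : i < J) :
    (i : ℂ) * contraction i =
      -∑ n ∈ Finset.range J, (1 - (-1 : ℂ) ^ (n + 1)) * contraction (i - (n + 1)) := by
  have h1 : ∑ n ∈ Finset.range J, (1 - (-1 : ℂ) ^ (n + 1)) * contraction (i - (n + 1)) =
      ∑ n ∈ Finset.range i, (1 - (-1 : ℂ) ^ (n + 1)) * contraction (i - (n + 1)) := by
    refine (Finset.sum_subset (Finset.range_mono hi.le) fun n _ hn => ?_).symm
    have hn : i ≤ n := by simpa using hn
    rw [contraction_of_neg (by omega), mul_zero]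
  rw [h1, ← Finset.sum_range_reflect]
  rcases i with _ | i
  · simp
  have h2 : ∀ j ∈ Finset.range (i + 1),
      (1 - (-1 : ℂ) ^ (i + 1 - 1 - j + 1)) *
        contraction ((i + 1 : ℕ) - ((i + 1 - 1 - j : ℕ) + 1)) =
      contraction j - (-1) ^ (i + 1) * ((-1) ^ j * contraction j) := by
    intro j hj
    have hj := Finset.mem_range.mp hj
    have e1 : ((i + 1 : ℕ) : ℤ) - ((i + 1 - 1 - j : ℕ) + 1) = j := by omega
    have e2 : (-1 : ℂ) ^ (i + 1 - 1 - j + 1) = (-1) ^ (i + 1) * (-1) ^ j := by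
      have : (-1 : ℂ) ^ (i + 1) = (-1) ^ (i + 1 - 1 - j + 1) * (-1) ^ j := by
        rw [← pow_add]; congr 1; omega
      rw [this, mul_assoc, ← mul_pow]
      norm_num
    rw [e1, e2]
    ring
  rw [Finset.sum_congr rfl h2, Finset.sum_sub_distrib, ← Finset.mul_sum,
    (sum_range_contraction i).1, (sum_range_contraction i).2,
    contraction_of_pos (by exact_mod_cast i.succ_pos), zpow_natCast]
  push_cast
  ring

/-- The exponential of derivations is the substitution tₙ ↦ tₙ - x⁻ⁿ/n, a ring homomorphism. It
multiplies exp(∑ (1 - (-1)ⁿ) tₙ yⁿ) by exp(-∑ (1 - (-1)ⁿ)(y/x)ⁿ/n) = (1 - y/x)/(1 + y/x). The proof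
compares Euler recursions, by strong induction on p. -/
theorem shiftOp_qfun_mul (j p : ℤ) (J : ℕ) (hp : p < J) (g : Poly) :
    shiftOp p (qfun j * g) =
      ∑ i ∈ Finset.range J, contraction i • (qfun (j - i) * shiftOp (p - i) g) := by
  rcases lt_or_ge p 0 with h0 | h0
  · rw [shiftOp_of_neg h0]
    refine (Finset.sum_eq_zero fun i _ => ?_).symm
    rw [shiftOp_of_neg (by omega), LinearMap.zero_apply, mul_zero, smul_zero]
  lift p to ℕ using h0
  induction p using Nat.strong_induction_on generalizing j g with
  | _ p ih =>
    have ih' : ∀ n : ℕ, ∀ j : ℤ, ∀ g : Poly, shiftOp (p - (n + 1)) (qfun j * g) =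
        ∑ i ∈ Finset.range J, contraction i •
          (qfun (j - i) * shiftOp (p - (n + 1) - i) g) := by
      intro n j g
      rcases lt_or_ge ((p : ℤ) - (n + 1)) 0 with h0 | h0
      · rw [shiftOp_of_neg h0]
        refine (Finset.sum_eq_zero fun i _ => ?_).symm
        rw [shiftOp_of_neg (by omega), LinearMap.zero_apply, mul_zero, smul_zero]
      · have : (p : ℤ) - (n + 1) = ((p - (n + 1) : ℕ) : ℤ) := by omega
        rw [this]
        exact ih (p - (n + 1)) (by omega) j g (by omega)
    rcases Nat.eq_zero_or_pos p with h | h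
    · subst h
      rw [Finset.sum_eq_single_of_mem 0 (by simp; omega)]
      · simp [contraction_zero, shiftOp_zero]
      · intro i _ hi
        rw [shiftOp_of_neg (by omega), LinearMap.zero_apply, mul_zero, smul_zero]
    · refine eq_of_natCast_smul h ?_
      have e1 := smul_shiftOp_apply p J hp.le (qfun j * g)
      rw [Int.cast_natCast] at e1
      rw [e1]
      have e2 : ∀ n : ℕ, shiftOp (p - (n + 1)) (partialT n.succPNat (qfun j * g)) =
          ∑ i ∈ Finset.range J, (contraction i * (1 - (-1 : ℂ) ^ (n + 1))) •
            (qfun (j - (n + 1) - i) * shiftOp (p - (n + 1) - i) g) +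
          ∑ i ∈ Finset.range J, contraction i •
            (qfun (j - i) * shiftOp (p - i - (n + 1)) (partialT n.succPNat g)) := by
        intro n
        rw [partialT_mul, partialT_qfun, map_add, smul_mul_assoc, map_smul, ih', ih',
          Finset.smul_sum]
        congr 1
        · refine Finset.sum_congr rfl fun i _ => ?_
          rw [smul_smul, mul_comm]
        · refine Finset.sum_congr rfl fun i _ => ?_
          rw [sub_right_comm]
      have e3 : ∀ n : ℕ, ∑ i ∈ Finset.range J, (contraction i * (1 - (-1 : ℂ) ^ (n + 1))) •
            (qfun (j - (n + 1) - i) * shiftOp (p - (n + 1) - i) g) =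
          ∑ k ∈ Finset.range J, ((1 - (-1 : ℂ) ^ (n + 1)) * contraction (k - (n + 1))) •
            (qfun (j - k) * shiftOp (p - k) g) := by
        intro n
        rw [← sum_range_add_eq (fun k : ℕ => ((1 - (-1 : ℂ) ^ (n + 1)) *
          contraction (k - (n + 1))) • (qfun (j - k) * shiftOp (p - k) g)) (n + 1) J]
        · refine Finset.sum_congr rfl fun i _ => ?_
          have h1 : ((i + (n + 1) : ℕ) : ℤ) - (n + 1) = i := by push_cast; ring
          have h2 : j - ((i + (n + 1) : ℕ) : ℤ) = j - (n + 1) - i := by push_cast; ring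
          have h3 : (p : ℤ) - ((i + (n + 1) : ℕ) : ℤ) = p - (n + 1) - i := by push_cast; ring
          rw [h1, h2, h3, mul_comm]
        · intro k hk
          rw [contraction_of_neg (by omega), mul_zero, zero_smul]
        · intro k hk
          rw [shiftOp_of_neg (by omega), LinearMap.zero_apply, mul_zero, smul_zero]
      simp only [e2, e3]
      rw [Finset.sum_add_distrib, Finset.sum_comm, neg_add]
      nth_rewrite 2 [Finset.sum_comm]
      rw [← Finset.sum_neg_distrib, ← Finset.sum_neg_distrib, ← Finset.sum_add_distrib,
        Finset.smul_sum]
      refine Finset.sum_congr rfl fun i hi => ?_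
      have hi := Finset.mem_range.mp hi
      have e4 := smul_shiftOp_apply ((p : ℤ) - i) J (by omega) g
      rw [← Finset.sum_smul, ← neg_smul, ← mul_contraction i J hi, ← Finset.smul_sum,
        ← Finset.mul_sum, ← smul_neg, ← mul_neg, ← e4, mul_smul_comm, smul_smul, smul_smul,
        ← add_smul]
      congr 1
      push_cast
      ring

/-! ### Local finiteness -/

/-- The substitution tₙ ↦ tₙ - x⁻ⁿ/n on a single variable; it lets local finiteness be proved by
induction on polynomials. -/
theorem shiftOp_X_mul (n : ℕ) (q : ℤ) (f : Poly) :
    shiftOp q ((MvPolynomial.X n.succPNat : Poly) * f) = MvPolynomial.X n.succPNat * shiftOp q f -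
      ((n : ℂ) + 1)⁻¹ • shiftOp (q - (n + 1)) f := by
  rcases lt_or_ge q 0 with hq | hq
  · rw [shiftOp_of_neg hq, shiftOp_of_neg (by omega)]
    simp
  lift q to ℕ using hq
  induction q using Nat.strong_induction_on generalizing f with
  | _ q ih =>
    rcases Nat.eq_zero_or_pos q with h | h
    · subst h
      rw [shiftOp_of_neg (n := ((0 : ℕ) : ℤ) - (n + 1)) (by omega), Nat.cast_zero, shiftOp_zero]
      simp
    · refine eq_of_natCast_smul h ?_
      have hL : (q : ℤ) ≤ (q + n + 1 : ℕ) := by omega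
      have e1 := smul_shiftOp_apply q (q + n + 1) hL (MvPolynomial.X n.succPNat * f)
      have e2 := smul_shiftOp_apply q (q + n + 1) hL f
      have e3 := smul_shiftOp_apply ((q : ℤ) - (n + 1)) (q + n + 1) (by omega) f
      rw [Int.cast_natCast] at e1 e2
      have e4 : ∀ i ∈ Finset.range (q + n + 1),
          shiftOp ((q : ℤ) - (i + 1)) (partialT i.succPNat (MvPolynomial.X n.succPNat * f)) =
          (if i = n then shiftOp ((q : ℤ) - (n + 1)) f else 0) +
          (MvPolynomial.X n.succPNat * shiftOp ((q : ℤ) - (i + 1)) (partialT i.succPNat f) -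
          ((n : ℂ) + 1)⁻¹ • shiftOp ((q : ℤ) - (n + 1) - (i + 1)) (partialT i.succPNat f)) := by
        intro i _
        rw [partialT_mul, map_add, partialT_X]
        congr 1
        · by_cases hin : i = n
          · subst hin
            simp
          · have : n.succPNat ≠ i.succPNat := fun h' => hin (Nat.succPNat_injective h').symm
            simp [hin, this]
        · rcases lt_or_ge ((q : ℤ) - (i + 1)) 0 with h0 | h0
          · rw [shiftOp_of_neg h0, shiftOp_of_neg (by omega)]
            simp
          · have h1 : (q : ℤ) - (i + 1) = ((q - (i + 1) : ℕ) : ℤ) := by omega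
            rw [sub_right_comm, h1, ih _ (by omega)]
      rw [e1, Finset.sum_congr rfl e4, Finset.sum_add_distrib, Finset.sum_ite_eq' _ n,
        if_pos (by simp), Finset.sum_sub_distrib, ← Finset.mul_sum, ← Finset.smul_sum,
        smul_sub, ← mul_smul_comm, e2, smul_comm, ← neg_eq_iff_eq_neg.mpr e3]
      have hn : (n : ℂ) + 1 ≠ 0 := by exact_mod_cast n.succ_ne_zero
      have e5 : ((q : ℂ) • shiftOp ((q : ℤ) - (n + 1)) f) =
          ((n : ℂ) + 1) • shiftOp ((q : ℤ) - (n + 1)) f +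
          (((q : ℤ) - (n + 1) : ℤ) : ℂ) • shiftOp ((q : ℤ) - (n + 1)) f := by
        rw [← add_smul]
        congr 1
        push_cast
        ring
      rw [e5, smul_add, smul_smul, inv_mul_cancel₀ hn, one_smul, smul_neg, mul_neg]
      abel

theorem exists_shiftOp_eq_zero (f : Poly) :
    ∃ K : ℕ, ∀ q : ℤ, K ≤ q → shiftOp q f = 0 := by
  induction f using MvPolynomial.induction_on with
  | C a =>
    refine ⟨1, fun q hq => ?_⟩
    lift q to ℕ using by omega
    refine eq_of_natCast_smul (n := q) (by omega) ?_
    have := smul_shiftOp_apply q q le_rfl (MvPolynomial.C a : Poly)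
    rw [Int.cast_natCast] at this
    rw [this, smul_zero, neg_eq_zero]
    refine Finset.sum_eq_zero fun i _ => ?_
    have : partialT i.succPNat (MvPolynomial.C a : Poly) = 0 := MvPolynomial.pderiv_C
    rw [this, map_zero]
  | add f g hf hg =>
    obtain ⟨K, hK⟩ := hf
    obtain ⟨L, hL⟩ := hg
    refine ⟨max K L, fun q hq => ?_⟩
    rw [map_add, hK q (by omega), hL q (by omega), add_zero]
  | mul_X f n hf =>
    obtain ⟨K, hK⟩ := hf
    refine ⟨K + n, fun q hq => ?_⟩
    obtain ⟨i, rfl⟩ : ∃ i : ℕ, n = i.succPNat := ⟨n.natPred, (PNat.succPNat_natPred n).symm⟩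
    have hi : ((i.succPNat : ℕ+) : ℕ) = i + 1 := rfl
    rw [mul_comm, shiftOp_X_mul, hK q (by omega), hK _ (by omega)]
    simp

/-! ### Vertex operators as linear maps -/

theorem B_eq_sum {f : Poly} {K : ℕ} (hK : ∀ q : ℤ, K ≤ q → shiftOp q f = 0) (n : ℤ) :
    B (-1) n f = ∑ q ∈ Finset.range K, qfun (n + q) * shiftOp q f := by
  have h : ∀ q : ℕ, (if 0 ≤ n + (q : ℤ) then PowerSeries.coeff (n + (q : ℤ)).toNat
      (vertexPlus (-1)) * PowerSeries.coeff q vertexMinus f else 0) =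
      qfun (n + q) * shiftOp q f := by
    intro q
    rw [qfun, shiftOp, zcoeff_natCast, zcoeff]
    split_ifs <;> simp
  rw [B]
  simp only [h]
  refine finsum_eq_sum_of_support_subset _ fun q hq => ?_
  rw [Finset.coe_range, Set.mem_Iio]
  by_contra hq'
  exact hq (by beta_reduce; rw [hK q (by exact_mod_cast not_lt.mp hq'), mul_zero])

theorem exists_common_bound (f g : Poly) : ∃ K : ℕ,
    (∀ q : ℤ, K ≤ q → shiftOp q f = 0) ∧ ∀ q : ℤ, K ≤ q → shiftOp q g = 0 := by
  obtain ⟨K, hK⟩ := exists_shiftOp_eq_zero f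
  obtain ⟨L, hL⟩ := exists_shiftOp_eq_zero g
  exact ⟨max K L, fun q hq => hK q (by omega), fun q hq => hL q (by omega)⟩

/-- The vertex operator `Bₙ` at `ρ = -1` as a linear map. -/
def vertexOp (n : ℤ) : Module.End ℂ Poly where
  toFun := B (-1) n
  map_add' f g := by
    obtain ⟨K, hf, hg⟩ := exists_common_bound f g
    rw [B_eq_sum hf, B_eq_sum hg, B_eq_sum (K := K), ← Finset.sum_add_distrib]
    · simp only [map_add, mul_add]
    · intro q hq
      rw [map_add, hf q hq, hg q hq, add_zero]
  map_smul' c f := by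
    obtain ⟨K, hf⟩ := exists_shiftOp_eq_zero f
    rw [B_eq_sum hf, B_eq_sum (K := K)]
    · simp only [map_smul, mul_smul_comm, Finset.smul_sum, RingHom.id_apply]
    · intro q hq
      rw [map_smul, hf q hq, smul_zero]

theorem vertexOp_eq_sum {f : Poly} {K : ℕ} (hK : ∀ q : ℤ, K ≤ q → shiftOp q f = 0) (n : ℤ) :
    vertexOp n f = ∑ q ∈ Finset.range K, qfun (n + q) * shiftOp q f := B_eq_sum hK n

theorem shiftOp_shiftOp_eq_zero {f : Poly} {K : ℕ} (hK : ∀ q : ℤ, K ≤ q → shiftOp q f = 0)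
    (p q : ℤ) (hq : K ≤ q) : shiftOp q (shiftOp p f) = 0 := by
  rw [shiftOp_shiftOp, hK q hq, map_zero]

theorem vertexOp_of_neg {f : Poly} {K : ℕ} (hK : ∀ q : ℤ, K ≤ q → shiftOp q f = 0) {n : ℤ}
    (hn : n + K ≤ 0) : vertexOp n f = 0 := by
  rw [vertexOp_eq_sum hK]
  refine Finset.sum_eq_zero fun q hq => ?_
  have := Finset.mem_range.mp hq
  rw [qfun_of_neg (by omega), zero_mul]

theorem vertexOp_qfun_mul (a j : ℤ) (J : ℕ) (hJ : j < J) (g : Poly) :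
    vertexOp a (qfun j * g) =
      ∑ i ∈ Finset.range J, contraction i • (qfun (j - i) * vertexOp (a + i) g) := by
  obtain ⟨K, hg, hK⟩ := exists_common_bound g (qfun j * g)
  have hK' : ∀ q : ℤ, (K + J : ℕ) ≤ q → shiftOp q (qfun j * g) = 0 :=
    fun q hq => hK q (by omega)
  rw [vertexOp_eq_sum hK']
  have e1 : ∀ p ∈ Finset.range (K + J), qfun (a + p) * shiftOp p (qfun j * g) =
      ∑ i ∈ Finset.range (K + J), contraction i •
        (qfun (j - i) * (qfun (a + p) * shiftOp (p - i) g)) := by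
    intro p hp
    have hp := Finset.mem_range.mp hp
    rw [shiftOp_qfun_mul j p (K + J) (by omega), Finset.mul_sum]
    refine Finset.sum_congr rfl fun i _ => ?_
    rw [mul_smul_comm, mul_left_comm]
  rw [Finset.sum_congr rfl e1, Finset.sum_comm]
  rw [← Finset.sum_subset (Finset.range_mono (Nat.le_add_left J K))]
  · refine Finset.sum_congr rfl fun i hi => ?_
    have hi := Finset.mem_range.mp hi
    rw [← Finset.smul_sum, ← Finset.mul_sum, vertexOp_eq_sum (K := K + J)
      (fun q hq => hg q (by omega)), ← sum_range_add_eq _ i (K + J)]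
    · congr 2
      refine Finset.sum_congr rfl fun p _ => ?_
      have h1 : a + ((p + i : ℕ) : ℤ) = a + i + p := by push_cast; ring
      have h2 : ((p + i : ℕ) : ℤ) - i = p := by push_cast; ring
      rw [h1, h2]
    · intro k hk
      rw [shiftOp_of_neg (by omega), LinearMap.zero_apply, mul_zero]
    · intro k hk
      rw [hg _ (by omega), mul_zero]
  · intro i _ hi
    have hi : J ≤ i := by simpa using hi
    refine Finset.sum_eq_zero fun p _ => ?_
    rw [qfun_of_neg (n := j - i) (by omega), zero_mul, smul_zero]

/-! ### Cancellation F(x)F(-x) = 1 and odd polynomials -/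

/-- Abstract form of F(x)F(-x) = 1 when x F′/F is odd: `y p q` is the coefficient of x^p y^q in
F(x)F(y), and `D n` is the action of the (n+1)-st term of the logarithmic derivative. It is used for
both factors of the vertex operator. -/
theorem alternating_sum_eq {M : Type*} [AddCommGroup M] [Module ℂ M] (y : ℤ → ℤ → M)
    (D : ℕ → ℤ → ℤ → M) (hy : ∀ p q, p < 0 ∨ q < 0 → y p q = 0)
    (hD : ∀ n p q, p < 0 ∨ q < 0 → D n p q = 0)
    (heven : ∀ n p q, Even (n + 1) → D n p q = 0)
    (h1 : ∀ p q : ℤ, ∀ L : ℕ, p ≤ L →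
      (p : ℂ) • y p q = ∑ n ∈ Finset.range L, D n (p - (n + 1)) q)
    (h2 : ∀ p q : ℤ, ∀ L : ℕ, q ≤ L →
      (q : ℂ) • y p q = ∑ n ∈ Finset.range L, D n p (q - (n + 1)))
    (r : ℤ) (L : ℕ) (hL : r < L) (hL0 : 0 < L) :
    ∑ q ∈ Finset.range L, ((-1 : ℂ) ^ q) • y (r - q) q = if r = 0 then y 0 0 else 0 := by
  split_ifs with hr
  · subst hr
    rw [Finset.sum_eq_single_of_mem 0 (by simpa using hL0)]
    · simp
    · intro q _ hq
      rw [hy _ _ (Or.inl (by omega)), smul_zero]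
  rcases lt_or_gt_of_ne hr with hr | hr
  · refine Finset.sum_eq_zero fun q _ => ?_
    rw [hy _ _ (Or.inl (by omega)), smul_zero]
  lift r to ℕ using hr.le
  refine eq_of_natCast_smul (n := r) (by omega) ?_
  rw [smul_zero, Finset.smul_sum]
  have e1 : ∀ q ∈ Finset.range L, (r : ℂ) • ((-1 : ℂ) ^ q) • y (r - q) q =
      ∑ n ∈ Finset.range L, ((-1 : ℂ) ^ q) • (D n (r - q - (n + 1)) q +
        D n (r - q) (q - (n + 1))) := by
    intro q hq
    have hq := Finset.mem_range.mp hq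
    rw [← Finset.smul_sum, Finset.sum_add_distrib, ← h1 _ _ L (by omega),
      ← h2 _ _ L (by omega), ← add_smul, smul_comm]
    congr 2
    push_cast
    ring
  rw [Finset.sum_congr rfl e1, Finset.sum_comm]
  refine Finset.sum_eq_zero fun n _ => ?_
  rcases Nat.even_or_odd (n + 1) with hn | hn
  · refine Finset.sum_eq_zero fun q _ => ?_
    rw [heven _ _ _ hn, heven _ _ _ hn, add_zero, smul_zero]
  · simp only [smul_add]
    -- For odd n + 1, shifting q by n + 1 in the second sum turns its terms into the negatives of
    -- those of the first.
    rw [Finset.sum_add_distrib,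
      ← sum_range_add_eq (fun q : ℕ => ((-1 : ℂ) ^ q) • D n (r - q) (q - (n + 1))) (n + 1) L,
      ← Finset.sum_add_distrib]
    · refine Finset.sum_eq_zero fun q _ => ?_
      have e2 : (r : ℤ) - ((q + (n + 1) : ℕ) : ℤ) = r - q - (n + 1) := by push_cast; ring
      have e3 : ((q + (n + 1) : ℕ) : ℤ) - (n + 1) = q := by push_cast; ring
      rw [e2, e3, pow_add, hn.neg_one_pow, mul_neg_one, neg_smul, add_neg_cancel]
    · intro k hk
      rw [hD _ _ _ (Or.inr (by omega)), smul_zero]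
    · intro k hk
      rw [hD _ _ _ (Or.inl (by omega)), smul_zero]

theorem alternating_sum_qfun (r : ℤ) (L : ℕ) (hL : r < L) (hL0 : 0 < L) :
    ∑ q ∈ Finset.range L, ((-1 : ℂ) ^ q) • (qfun (r - q) * qfun q) = if r = 0 then 1 else 0 := by
  have h := alternating_sum_eq (fun p q => qfun p * qfun q)
    (fun n p q => (oddWeight (n + 1) • (MvPolynomial.X n.succPNat : Poly)) * (qfun p * qfun q))
    ?_ ?_ ?_ ?_ ?_ r L hL hL0
  · simpa only [qfun_zero, mul_one] using h
  · rintro p q (h | h) <;> simp [qfun_of_neg h]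
  · rintro n p q (h | h) <;> simp [qfun_of_neg h]
  · intro n p q hn
    simp [oddWeight, hn.neg_one_pow]
  · intro p q L hL
    rw [← smul_mul_assoc, smul_qfun p L hL, Finset.sum_mul]
    simp only [mul_assoc]
  · intro p q L hL
    rw [← mul_smul_comm, smul_qfun q L hL, Finset.mul_sum]
    simp only [mul_left_comm]

/-- A polynomial that only involves the variables with odd index. -/
def IsOdd (f : Poly) : Prop := ∀ n : ℕ, Even (n + 1) → partialT n.succPNat f = 0

theorem isOdd_one : IsOdd 1 := fun n _ => by
  change MvPolynomial.pderiv _ (1 : Poly) = 0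
  simp

theorem isOdd_qfun (j : ℤ) : IsOdd (qfun j) := fun n hn => by
  rw [partialT_qfun, hn.neg_one_pow, sub_self, zero_smul]

theorem IsOdd.mul {f g : Poly} (hf : IsOdd f) (hg : IsOdd g) : IsOdd (f * g) := fun n hn => by
  rw [partialT_mul, hf n hn, hg n hn, zero_mul, mul_zero, add_zero]

theorem IsOdd.sum {ι : Type*} {s : Finset ι} {F : ι → Poly} (h : ∀ i ∈ s, IsOdd (F i)) :
    IsOdd (∑ i ∈ s, F i) := fun n hn => by
  rw [map_sum]
  exact Finset.sum_eq_zero fun i hi => h i hi n hn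

theorem IsOdd.shiftOp {f : Poly} (hf : IsOdd f) (q : ℤ) : IsOdd (shiftOp q f) := fun n hn => by
  rw [← shiftOp_partialT, hf n hn, map_zero]

theorem IsOdd.partialT {f : Poly} (hf : IsOdd f) (n : ℕ+) : IsOdd (partialT n f) :=
  fun i hi => by
    have := LinearMap.congr_fun (partialT_commute i.succPNat n).eq f
    simp only [Module.End.mul_apply] at this
    rw [this, hf i hi, map_zero]

theorem IsOdd.vertexOp {f : Poly} (hf : IsOdd f) (n : ℤ) : IsOdd (vertexOp n f) := by
  obtain ⟨K, hK⟩ := exists_shiftOp_eq_zero f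
  rw [vertexOp_eq_sum hK]
  exact IsOdd.sum fun i _ => (isOdd_qfun _).mul (hf.shiftOp _)

theorem alternating_sum_shiftOp {f : Poly} (hf : IsOdd f) (r : ℤ) (L : ℕ) (hL : r < L)
    (hL0 : 0 < L) :
    ∑ q ∈ Finset.range L, ((-1 : ℂ) ^ q) • shiftOp (r - q) (shiftOp q f) =
      if r = 0 then f else 0 := by
  have h := alternating_sum_eq (fun p q => shiftOp p (shiftOp q f))
    (fun n p q => -shiftOp p (shiftOp q (partialT n.succPNat f)))
    ?_ ?_ ?_ ?_ ?_ r L hL hL0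
  · simpa only [shiftOp_zero, Module.End.one_apply] using h
  · rintro p q (h | h) <;> simp [shiftOp_of_neg h]
  · rintro n p q (h | h) <;> simp [shiftOp_of_neg h]
  · intro n p q hn
    rw [hf n hn, map_zero, map_zero, neg_zero]
  · intro p q L hL
    rw [smul_shiftOp_apply p L hL, Finset.sum_neg_distrib]
    simp only [shiftOp_partialT]
  · intro p q L hL
    rw [← map_smul, smul_shiftOp_apply q L hL, map_neg, map_sum, Finset.sum_neg_distrib]

/-! ### The normally ordered product of two vertex operators -/

/-- The coefficient of `x^a y^b` in the normally ordered product `:B(x) B(y):`. -/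
def normalOp (a b : ℤ) (f : Poly) : Poly :=
  ∑ᶠ q : ℕ, qfun (b + q) * vertexOp a (shiftOp q f)

theorem sum_qfun_mul_qfun (s p q : ℤ) (M : ℕ) (hp0 : 0 ≤ p) (hp : p ≤ M) (hM : s + q ≤ M) :
    ∑ j ∈ Finset.Icc (-(M : ℤ)) M, ((-1 : ℂ) ^ j) • (qfun (j + p) * qfun (s - j + q)) =
      if s + p + q = 0 then (((-1 : ℂ) ^ p) • (1 : Poly)) else 0 := by
  have h := alternating_sum_qfun (s + p + q) (M + p + 1).toNat (by omega) (by omega)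
  have h1 : (if s + p + q = 0 then (((-1 : ℂ) ^ p) • (1 : Poly)) else 0) =
      ((-1 : ℂ) ^ p) • (if s + p + q = 0 then (1 : Poly) else 0) := by
    rw [smul_ite, smul_zero]
  rw [h1, ← h, Finset.smul_sum,
    ← Finset.sum_subset (Finset.Icc_subset_Icc_left (neg_le_neg hp))]
  · refine Finset.sum_nbij' (fun j => (j + p).toNat) (fun i : ℕ => (i : ℤ) - p) ?_ ?_ ?_ ?_ ?_
    · intro i hi
      simp only [Finset.mem_range, Finset.mem_Icc] at hi ⊢
      omega
    · intro i hi
      simp only [Finset.mem_range, Finset.mem_Icc] at hi ⊢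
      omega
    · intro i hi
      simp only [Finset.mem_Icc] at hi
      omega
    · intro i _
      omega
    · intro j hj
      simp only [Finset.mem_Icc] at hj
      have e1 : (((j + p).toNat : ℕ) : ℤ) = j + p := by omega
      have e2 : s + p + q - (j + p) = s - j + q := by ring
      have hne : (-1 : ℂ) ≠ 0 := by norm_num
      rw [← zpow_natCast, e1, e2, smul_smul, ← zpow_add₀ hne, mul_comm (qfun (j + p))]
      congr 1
      have e3 : p + (j + p) = j + 2 * p := by ring
      rw [e3, zpow_add₀ hne, (even_two_mul p).neg_one_zpow, mul_one]
  · intro j _ hj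
    rw [qfun_of_neg (n := j + p), zero_mul, smul_zero]
    simp only [Finset.mem_Icc] at *
    omega

section Bounded

variable {f : Poly} {K : ℕ} (hK : ∀ q : ℤ, K ≤ q → shiftOp q f = 0)

include hK

theorem normalOp_eq_sum (a b : ℤ) :
    normalOp a b f = ∑ q ∈ Finset.range K, qfun (b + q) * vertexOp a (shiftOp q f) := by
  refine finsum_eq_sum_of_support_subset _ fun q hq => ?_
  rw [Finset.coe_range, Set.mem_Iio]
  by_contra hq'
  exact hq (by beta_reduce; rw [hK q (by exact_mod_cast not_lt.mp hq'), map_zero, mul_zero])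

theorem normalOp_eq_double_sum (a b : ℤ) :
    normalOp a b f = ∑ q ∈ Finset.range K, ∑ p ∈ Finset.range K,
      qfun (a + p) * qfun (b + q) * shiftOp p (shiftOp q f) := by
  rw [normalOp_eq_sum hK]
  refine Finset.sum_congr rfl fun q _ => ?_
  rw [vertexOp_eq_sum (fun p hp => shiftOp_shiftOp_eq_zero hK q p hp), Finset.mul_sum]
  refine Finset.sum_congr rfl fun p _ => ?_
  rw [mul_comm (qfun (a + p)) (qfun (b + q)), mul_assoc (qfun (b + q))]

theorem normalOp_comm (a b : ℤ) : normalOp a b f = normalOp b a f := by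
  rw [normalOp_eq_double_sum hK, normalOp_eq_double_sum hK, Finset.sum_comm]
  refine Finset.sum_congr rfl fun q _ => Finset.sum_congr rfl fun p _ => ?_
  rw [shiftOp_shiftOp, mul_comm (qfun (a + q))]

theorem normalOp_of_right_neg (a : ℤ) {b : ℤ} (hb : b + K ≤ 0) : normalOp a b f = 0 := by
  rw [normalOp_eq_sum hK]
  refine Finset.sum_eq_zero fun q hq => ?_
  have := Finset.mem_range.mp hq
  rw [qfun_of_neg (by omega), zero_mul]

theorem normalOp_of_left_neg {a : ℤ} (b : ℤ) (ha : a + K ≤ 0) : normalOp a b f = 0 := by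
  rw [normalOp_comm hK, normalOp_of_right_neg hK b ha]

theorem vertexOp_vertexOp (a b : ℤ) (J : ℕ) (hJ : b + K ≤ J) :
    vertexOp a (vertexOp b f) =
      ∑ i ∈ Finset.range J, contraction i • normalOp (a + i) (b - i) f := by
  rw [vertexOp_eq_sum hK, map_sum]
  have e1 : ∀ q ∈ Finset.range K, vertexOp a (qfun (b + q) * shiftOp q f) =
      ∑ i ∈ Finset.range J, contraction i •
        (qfun (b - i + q) * vertexOp (a + i) (shiftOp q f)) := by
    intro q hq
    have := Finset.mem_range.mp hq
    rw [vertexOp_qfun_mul a (b + q) J (by omega)]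
    refine Finset.sum_congr rfl fun i _ => ?_
    rw [add_sub_right_comm]
  rw [Finset.sum_congr rfl e1, Finset.sum_comm]
  refine Finset.sum_congr rfl fun i _ => ?_
  rw [normalOp_eq_sum hK, Finset.smul_sum]

/-- Together with `vertexOp_vertexOp_right` this expands both orders of two vertex operators in one
family of normally ordered products over one interval, so that they can be added termwise. -/
theorem vertexOp_vertexOp_left (a s : ℤ) (M : ℕ) (ha : -(M : ℤ) ≤ a) (hM : s + K ≤ M) :
    vertexOp a (vertexOp (s - a) f) =
      ∑ j ∈ Finset.Icc (-(M : ℤ)) M, contraction (j - a) • normalOp j (s - j) f := by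
  rw [vertexOp_vertexOp hK a (s - a) (M - a + 1).toNat (by omega),
    ← Finset.sum_subset (Finset.Icc_subset_Icc_left ha)]
  · refine Finset.sum_nbij' (fun i : ℕ => a + i) (fun j => (j - a).toNat) ?_ ?_ ?_ ?_ ?_
    · intro i hi
      simp only [Finset.mem_range, Finset.mem_Icc] at hi ⊢
      omega
    · intro i hi
      simp only [Finset.mem_range, Finset.mem_Icc] at hi ⊢
      omega
    · intro i _
      omega
    · intro i hi
      simp only [Finset.mem_Icc] at hi
      omega
    · intro i _
      rw [add_sub_cancel_left, sub_sub]
  · intro j _ hj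
    rw [contraction_of_neg, zero_smul]
    simp only [Finset.mem_Icc] at *
    omega

/-- The symmetry `normalOp_comm` brings the exchanged order back to the same family, with the
argument of the contraction reversed. -/
theorem vertexOp_vertexOp_right (a s : ℤ) (M : ℕ) (ha : a ≤ M) (hM : K ≤ M) :
    vertexOp (s - a) (vertexOp a f) =
      ∑ j ∈ Finset.Icc (-(M : ℤ)) M, contraction (a - j) • normalOp j (s - j) f := by
  rcases lt_or_ge a (-(M : ℤ)) with h | h
  · rw [vertexOp_of_neg hK (by omega), map_zero]
    refine (Finset.sum_eq_zero fun j hj => ?_).symm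
    simp only [Finset.mem_Icc] at hj
    rw [contraction_of_neg (by omega), zero_smul]
  rw [vertexOp_vertexOp hK (s - a) a (a + M + 1).toNat (by omega),
    ← Finset.sum_subset (Finset.Icc_subset_Icc_right ha)]
  · refine Finset.sum_nbij' (fun i : ℕ => a - i) (fun j => (a - j).toNat) ?_ ?_ ?_ ?_ ?_
    · intro i hi
      simp only [Finset.mem_range, Finset.mem_Icc] at hi ⊢
      omega
    · intro i hi
      simp only [Finset.mem_range, Finset.mem_Icc] at hi ⊢
      omega
    · intro i _
      omega
    · intro i hi
      simp only [Finset.mem_Icc] at hi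
      omega
    · intro i _
      rw [sub_sub_cancel, normalOp_comm hK, sub_sub_eq_add_sub, sub_add_eq_add_sub]
  · intro j _ hj
    rw [contraction_of_neg, zero_smul]
    simp only [Finset.mem_Icc] at *
    omega

/-- This is :B(x)B(-x): = 1. The multiplication factors cancel identically, the derivation factors
only on odd polynomials. -/
theorem alternating_sum_normalOp (hf : IsOdd f) (s : ℤ) (M : ℕ) (hM : K + |s| ≤ M) :
    ∑ j ∈ Finset.Icc (-(M : ℤ)) M, ((-1 : ℂ) ^ j) • normalOp j (s - j) f =
      if s = 0 then f else 0 := by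
  have hs := abs_le.mp (le_refl |s|)
  simp only [normalOp_eq_double_sum hK, Finset.smul_sum]
  rw [Finset.sum_comm]
  have e1 : ∀ q ∈ Finset.range K, ∑ j ∈ Finset.Icc (-(M : ℤ)) M, ∑ p ∈ Finset.range K,
      ((-1 : ℂ) ^ j) • (qfun (j + p) * qfun (s - j + q) * shiftOp p (shiftOp q f)) =
      ((-1 : ℂ) ^ s) • (((-1 : ℂ) ^ q) • shiftOp (-s - q) (shiftOp q f)) := by
    intro q hq
    have hq := Finset.mem_range.mp hq
    rw [Finset.sum_comm]
    have e2 : ∀ p ∈ Finset.range K, ∑ j ∈ Finset.Icc (-(M : ℤ)) M,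
        ((-1 : ℂ) ^ j) • (qfun (j + p) * qfun (s - j + q) * shiftOp p (shiftOp q f)) =
        if s + p + q = 0 then
          ((-1 : ℂ) ^ s) • (((-1 : ℂ) ^ q) • shiftOp (-s - q) (shiftOp q f)) else 0 := by
      intro p hp
      have hp := Finset.mem_range.mp hp
      simp only [← smul_mul_assoc]
      rw [← Finset.sum_mul]
      simp only [smul_mul_assoc]
      rw [sum_qfun_mul_qfun s p q M (by omega) (by omega) (by omega)]
      split_ifs with h
      · have e3 : -s - q = p := by omega
        have e4 : (p : ℤ) = -(s + q) := by omega
        have hne : (-1 : ℂ) ≠ 0 := by norm_num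
        rw [e3, smul_mul_assoc, one_mul, smul_smul, ← zpow_natCast (-1 : ℂ) q,
          ← zpow_add₀ hne]
        congr 1
        rw [e4, zpow_neg, ← inv_zpow, inv_neg_one]
      · rw [zero_mul]
    rw [Finset.sum_congr rfl e2]
    by_cases h : 0 ≤ -s - q ∧ -s - q < K
    · rw [Finset.sum_eq_single_of_mem (-s - q).toNat (by simp; omega), if_pos (by omega)]
      intro p _ hp
      rw [if_neg (by omega)]
    · have h3 : shiftOp (-s - q) (shiftOp q f) = 0 := by
        by_cases h4 : 0 ≤ -s - q
        · exact shiftOp_shiftOp_eq_zero hK _ _ (by omega)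
        · rw [shiftOp_of_neg (by omega)]
          rfl
      rw [h3, smul_zero, smul_zero]
      simp
  rw [Finset.sum_congr rfl e1, ← Finset.smul_sum]
  have e5 := alternating_sum_shiftOp hf (-s) (K + M + 1) (by omega) (by omega)
  rw [← Finset.sum_subset (Finset.range_mono (show K ≤ K + M + 1 by omega))] at e5
  · rw [e5]
    rcases eq_or_ne s 0 with rfl | h
    · simp
    · simp [h]
  · intro q _ hq
    rw [hK q (by simpa using hq), map_zero, smul_zero]

/-- The equation y ∂_y :B(x)B(y): = :yJ(y)B(x)B(y):, with multiplications on the left and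
derivations acting first. -/
theorem mul_normalOp (hd : ∀ n : ℕ, K ≤ n → partialT n.succPNat f = 0) (a b : ℤ) (L : ℕ)
    (hL : b + 2 * K ≤ L) (hL' : 2 * K ≤ L) :
    (b : ℂ) • normalOp a b f =
      ∑ n ∈ Finset.range L, (oddWeight (n + 1) • (MvPolynomial.X n.succPNat : Poly)) *
        normalOp a (b - (n + 1)) f +
      ∑ n ∈ Finset.range L, normalOp a (b + (n + 1)) (partialT n.succPNat f) := by
  have h0 : ∀ n, ∀ q : ℤ, K ≤ q → shiftOp q (partialT n f) = 0 := fun n q hq => by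
    rw [shiftOp_partialT, hK q hq, map_zero]
  have h0' : ∀ n, ∀ q : ℤ, (2 * K : ℕ) ≤ q → shiftOp q (partialT n f) = 0 :=
    fun n q hq => h0 n q (by omega)
  have hK' : ∀ q : ℤ, (2 * K : ℕ) ≤ q → shiftOp q f = 0 := fun q hq => hK q (by omega)
  have e1 : ∀ q ∈ Finset.range (2 * K), (b : ℂ) • (qfun (b + q) * vertexOp a (shiftOp q f)) =
      ∑ n ∈ Finset.range L, (oddWeight (n + 1) • (MvPolynomial.X n.succPNat : Poly)) *
        (qfun (b - (n + 1) + q) * vertexOp a (shiftOp q f)) +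
      ∑ n ∈ Finset.range L, qfun (b + q) *
        vertexOp a (shiftOp (q - (n + 1)) (partialT n.succPNat f)) := by
    intro q hq
    have hq := Finset.mem_range.mp hq
    have h1 := smul_qfun (b + q) L (by omega)
    have h2 := smul_shiftOp_apply q L (by omega) f
    rw [← neg_eq_iff_eq_neg] at h2
    simp only [← mul_assoc, ← Finset.mul_sum, ← map_sum]
    rw [← h2]
    have h3 : ∑ n ∈ Finset.range L, (oddWeight (n + 1) • (MvPolynomial.X n.succPNat : Poly)) *
        qfun (b - (n + 1) + q) * vertexOp a (shiftOp q f) =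
        (((b + q : ℤ) : ℂ) • qfun (b + q)) * vertexOp a (shiftOp q f) := by
      rw [h1, Finset.sum_mul]
      refine Finset.sum_congr rfl fun n _ => ?_
      rw [sub_add_eq_add_sub]
    rw [h3, map_neg, map_smul, mul_neg, mul_smul_comm, smul_mul_assoc, ← sub_eq_add_neg,
      ← sub_smul]
    congr 1
    push_cast
    ring
  rw [normalOp_eq_sum hK', Finset.smul_sum, Finset.sum_congr rfl e1, Finset.sum_add_distrib,
    Finset.sum_comm]
  congr 1
  · refine Finset.sum_congr rfl fun n _ => ?_
    rw [normalOp_eq_sum hK', Finset.mul_sum]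
  · rw [Finset.sum_comm]
    refine Finset.sum_congr rfl fun n _ => ?_
    rw [normalOp_eq_sum (h0' _), ← sum_range_add_eq (fun q : ℕ => qfun (b + q) *
        vertexOp a (shiftOp (q - (n + 1)) (partialT n.succPNat f))) (n + 1) (2 * K)]
    · refine Finset.sum_congr rfl fun q _ => ?_
      have h1 : b + ((q + (n + 1) : ℕ) : ℤ) = b + (n + 1) + q := by push_cast; ring
      have h2 : ((q + (n + 1) : ℕ) : ℤ) - (n + 1) = q := by push_cast; ring
      rw [h1, h2]
    · intro k hk
      rw [shiftOp_of_neg (by omega), LinearMap.zero_apply, map_zero, mul_zero]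
    · intro k hk
      -- The sums run to 2K because a shift by n + 1 ≤ K must stay above K; a larger n already kills
      -- f.
      rcases lt_or_ge n K with h | h
      · rw [h0 _ _ (by omega), map_zero, mul_zero]
      · rw [hd n h, map_zero, map_zero, mul_zero]

end Bounded

/-- The Clifford relations of the neutral fermions. -/
theorem vertexOp_anticommute {f : Poly} (hf : IsOdd f) (a b : ℤ) :
    vertexOp a (vertexOp b f) + vertexOp b (vertexOp a f) =
      if a + b = 0 then (2 * (-1 : ℂ) ^ a) • f else 0 := by
  obtain ⟨K, hK⟩ := exists_shiftOp_eq_zero f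
  obtain ⟨M, hM⟩ : ∃ M : ℕ, (M : ℤ) = K + |a + b| + |a| := ⟨_, Int.toNat_of_nonneg (by positivity)⟩
  have h1 := abs_le.mp (le_refl |a + b|)
  have h2 := abs_le.mp (le_refl |a|)
  have e1 := vertexOp_vertexOp_left hK a (a + b) M (by omega) (by omega)
  have e2 := vertexOp_vertexOp_right hK a (a + b) M (by omega) (by omega)
  rw [add_sub_cancel_left] at e1 e2
  have hne : (-1 : ℂ) ≠ 0 := by norm_num
  -- The two expansions of (1-u)/(1+u), at 0 and with u inverted, add up to the formal delta
  -- function 2 ∑ (-u)^j.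
  have e3 : ∀ j : ℤ, contraction (j - a) + contraction (a - j) =
      2 * (-1 : ℂ) ^ a * (-1) ^ j := by
    intro j
    have e4 : (-1 : ℂ) ^ (j - a) = (-1) ^ a * (-1) ^ j := by
      rw [zpow_sub₀ hne, div_eq_mul_inv, ← inv_zpow, inv_neg_one, mul_comm]
    have e5 : (-1 : ℂ) ^ (a - j) = (-1) ^ a * (-1) ^ j := by
      rw [zpow_sub₀ hne, div_eq_mul_inv, ← inv_zpow, inv_neg_one]
    rcases lt_trichotomy j a with h | h | h
    · rw [contraction_of_neg (by omega), contraction_of_pos (by omega), e5, zero_add, mul_assoc]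
    · subst h
      rw [sub_self, contraction_zero, mul_assoc, ← mul_zpow]
      norm_num
    · rw [contraction_of_pos (by omega), contraction_of_neg (i := a - j) (by omega), e4, add_zero,
        mul_assoc]
  rw [e1, e2, ← Finset.sum_add_distrib]
  simp only [← add_smul, e3, mul_smul _ ((-1 : ℂ) ^ (_ : ℤ)) (normalOp _ _ _)]
  rw [← Finset.smul_sum, alternating_sum_normalOp hK hf (a + b) M (by omega), smul_ite, smul_zero]

/-! ### Iterated derivatives -/

theorem pairwise_commute_partialT_pow (β : ℕ+ →₀ ℕ) (s : Set ℕ+) :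
    s.Pairwise (Function.onFun Commute fun n => partialT n ^ β n) :=
  fun m _ n _ _ => (partialT_commute m n).pow_pow (β m) (β n)

theorem partialPow_eq_noncommProd (β : ℕ+ →₀ ℕ) (s : Finset ℕ+) (hs : β.support ⊆ s) :
    partialPow β =
      s.noncommProd (fun n => partialT n ^ β n) (pairwise_commute_partialT_pow β s) := by
  classical
  have h : s = β.support ∪ (s \ β.support) := (Finset.union_sdiff_of_subset hs).symm
  have h1 : (s \ β.support).noncommProd (fun n => partialT n ^ β n)
      (pairwise_commute_partialT_pow β _) = 1 := by
    rw [Finset.noncommProd_eq_pow_card _ _ _ 1, one_pow]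
    intro n hn
    have hn : β n = 0 := by simpa using (Finset.mem_sdiff.mp hn).2
    rw [hn, pow_zero]
  refine Eq.trans ?_ (Finset.noncommProd_congr h.symm (fun _ _ => rfl)
    (pairwise_commute_partialT_pow β _))
  rw [Finset.noncommProd_union_of_disjoint Finset.disjoint_sdiff, h1, mul_one]
  rfl

theorem partialPow_add (β γ : ℕ+ →₀ ℕ) : partialPow (β + γ) = partialPow β * partialPow γ := by
  classical
  rw [partialPow_eq_noncommProd (β + γ) (β.support ∪ γ.support) Finsupp.support_add,
    partialPow_eq_noncommProd β (β.support ∪ γ.support) Finset.subset_union_left,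
    partialPow_eq_noncommProd γ (β.support ∪ γ.support) Finset.subset_union_right,
    ← Finset.noncommProd_mul_distrib]
  · refine Finset.noncommProd_congr rfl (fun n _ => ?_) _
    rw [Finsupp.add_apply, pow_add, Pi.mul_apply]
  · exact fun m _ n _ _ => (partialT_commute m n).pow_pow _ _

theorem partialPow_zero : partialPow 0 = 1 := by
  rw [partialPow_eq_noncommProd 0 ∅ (by simp), Finset.noncommProd_empty]

theorem partialPow_single (n : ℕ+) : partialPow (Finsupp.single n 1) = partialT n := by
  rw [partialPow_eq_noncommProd (Finsupp.single n 1) {n} Finsupp.support_single_subset,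
    Finset.noncommProd_singleton, Finsupp.single_eq_same, pow_one]

theorem partialPow_add_single (β : ℕ+ →₀ ℕ) (n : ℕ+) (f : Poly) :
    partialPow (β + Finsupp.single n 1) f = partialPow β (partialT n f) := by
  rw [partialPow_add, partialPow_single, Module.End.mul_apply]

theorem exists_eq_add_single {σ : Type*} {β : σ →₀ ℕ} {n : σ} (h : β n ≠ 0) :
    β - Finsupp.single n 1 + Finsupp.single n 1 = β :=
  tsub_add_cancel_of_le (by simpa [Nat.one_le_iff_ne_zero] using h)

theorem le_of_partialPow_monomial_ne_zero (β m : ℕ+ →₀ ℕ) (c : ℂ)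
    (h : partialPow β (MvPolynomial.monomial m c) ≠ 0) : β ≤ m := by
  induction hd : β.degree generalizing β m c with
  | zero =>
    rw [(Finsupp.degree_eq_zero_iff β).mp hd]
    exact zero_le
  | succ d ih =>
    have hβ : β ≠ 0 := by
      rintro rfl
      simp at hd
    obtain ⟨n, hn⟩ := Finsupp.ne_iff.mp hβ
    have hβ' := exists_eq_add_single hn
    rw [← hβ', partialPow_add_single] at h
    have h1 : partialT n (MvPolynomial.monomial m c : Poly) =
        MvPolynomial.monomial (m - Finsupp.single n 1) (c * (m n : ℂ)) :=
      MvPolynomial.pderiv_monomial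
    rw [h1] at h
    have hm : m n ≠ 0 := by
      intro h0
      simp [h0] at h
    have h2 : (β - Finsupp.single n 1).degree = d := by
      have := congrArg Finsupp.degree hβ'
      rw [map_add, Finsupp.degree_single, hd] at this
      omega
    have h3 := ih _ _ _ h h2
    rw [← hβ', ← exists_eq_add_single hm]
    exact add_le_add_left h3 _

theorem finite_partialPow_ne_zero (f : Poly) : {β | partialPow β f ≠ 0}.Finite := by
  refine Set.Finite.subset (Set.Finite.biUnion f.support.finite_toSet
    fun m _ => Set.finite_Iic m) fun β hβ => ?_
  rw [Set.mem_ofPred_eq, f.as_sum, map_sum] at hβ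
  obtain ⟨m, hm, h⟩ := Finset.exists_ne_zero_of_sum_ne_zero hβ
  exact Set.mem_biUnion hm (le_of_partialPow_monomial_ne_zero β m _ h)

/-- The degree of a multi-index, for `deg tₙ = n`. -/
abbrev wt : (ℕ+ →₀ ℕ) →+ ℕ := Finsupp.weight (fun n : ℕ+ => (n : ℕ))

theorem le_wt {α : ℕ+ →₀ ℕ} {n : ℕ+} (h : α n ≠ 0) : (n : ℕ) ≤ wt α := by
  have := congrArg wt (exists_eq_add_single h)
  rw [map_add, Finsupp.weight_single, one_smul] at this
  omega

theorem finite_wt_le (N : ℕ) : {α | wt α ≤ N}.Finite := by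
  refine Set.Finite.subset (Set.finite_Iic
    (Finsupp.indicator (Finset.Icc 1 N.succPNat) fun _ _ => N)) fun α (hα : wt α ≤ N) => ?_
  intro n
  rcases eq_or_ne (α n) 0 with h | h
  · rw [h]
    exact Nat.zero_le _
  · have hn : n ∈ Finset.Icc 1 N.succPNat := by
      rw [Finset.mem_Icc]
      refine ⟨one_le, ?_⟩
      rw [← PNat.coe_le_coe, Nat.succPNat_coe]
      have := le_wt h
      omega
    rw [Finsupp.indicator_of_mem hn]
    exact (Finsupp.le_weight _ n.ne_zero α).trans hα

theorem exists_wt_bound (f : Poly) : ∃ N, ∀ β, partialPow β f ≠ 0 → wt β ≤ N := by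
  obtain ⟨N, hN⟩ := ((finite_partialPow_ne_zero f).image wt).bddAbove
  exact ⟨N, fun β hβ => hN (Set.mem_image_of_mem _ hβ)⟩

theorem exists_partialT_eq_zero (f : Poly) : ∃ N : ℕ, ∀ n, N ≤ n → partialT n.succPNat f = 0 := by
  obtain ⟨N, hN⟩ := exists_wt_bound f
  refine ⟨N, fun n hn => ?_⟩
  by_contra h
  rw [← partialPow_single] at h
  have := hN _ h
  rw [Finsupp.weight_single, one_smul, Nat.succPNat_coe] at this
  omega

/-! ### The symbols `(∂_z + J)^k · 1` -/

theorem coeff_laurentDeriv (p : ℂ[T;T⁻¹]) (j : ℤ) :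
    (laurentDeriv p).coeff j = ((j : ℂ) + 1) * p.coeff (j + 1) := by
  have h : ∀ (n : ℤ) (a : ℂ), (LaurentPolynomial.C ((n : ℂ) * a) *
      LaurentPolynomial.T (n - 1)).coeff j = if n = j + 1 then ((j : ℂ) + 1) * a else 0 := by
    intro n a
    rw [← LaurentPolynomial.single_eq_C_mul_T, AddMonoidAlgebra.coeff_single, Finsupp.single_apply]
    by_cases hn : n = j + 1
    · rw [if_pos (by omega), if_pos hn, hn]
      push_cast
      rfl
    · rw [if_neg (by omega), if_neg hn]
  rw [laurentDeriv, Finsupp.sum, AddMonoidAlgebra.coeff_sum, Finset.sum_apply']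
  simp only [h]
  rw [Finset.sum_ite_eq' _ (j + 1)]
  split_ifs with hj
  · rfl
  · rw [Finsupp.notMem_support_iff.mp hj, mul_zero]

theorem coeff_C_mul_T_mul (a : ℂ) (i : ℤ) (p : ℂ[T;T⁻¹]) (j : ℤ) :
    (LaurentPolynomial.C a * LaurentPolynomial.T i * p).coeff j = a * p.coeff (j - i) := by
  rw [← LaurentPolynomial.single_eq_C_mul_T]
  have := AddMonoidAlgebra.coeff_single_mul_eq_mul_coeff (r := a) (x := p) (m := i) (m₁ := j)
    (j - i) (fun m' _ => by omega)
  exact this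

/-- Only splittings of e that detach one letter contribute, one for each distinct letter, whatever
its multiplicity. -/
theorem coeff_linearSymb_mul (c : ℕ+ ⊕ ℕ+ → ℂ[T;T⁻¹]) (F : Symb) (e : ℕ+ ⊕ ℕ+ →₀ ℕ) :
    MvPowerSeries.coeff e (linearSymb c * F) =
      ∑ s ∈ e.support, c s * MvPowerSeries.coeff (e - Finsupp.single s 1) F := by
  classical
  rw [MvPowerSeries.coeff_mul]
  symm
  refine Finset.sum_of_injOn (fun s => (Finsupp.single s 1, e - Finsupp.single s 1)) ?_ ?_ ?_ ?_
  · intro s _ t _ h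
    exact Finsupp.single_left_injective one_ne_zero (Prod.ext_iff.mp h).1
  · intro s hs
    have hs : e s ≠ 0 := by simpa using hs
    rw [Finset.mem_coe, Finset.HasAntidiagonal.mem_antidiagonal, add_comm]
    exact exists_eq_add_single hs
  · rintro ⟨d, d'⟩ hd hd'
    have h1 : MvPowerSeries.coeff d (linearSymb c) =
        if d.degree = 1 then ∑ s ∈ d.support, c s else 0 := rfl
    dsimp only
    rw [h1, if_neg, zero_mul]
    intro hdeg
    have hd0 : d ≠ 0 := by
      rintro rfl
      simp at hdeg
    obtain ⟨s, hs⟩ := Finsupp.ne_iff.mp hd0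
    have h2 := exists_eq_add_single hs
    have h3 := congrArg Finsupp.degree h2
    rw [map_add, Finsupp.degree_single, hdeg] at h3
    have h4 : d - Finsupp.single s 1 = 0 := (Finsupp.degree_eq_zero_iff _).mp (by omega)
    rw [h4, zero_add] at h2
    have h5 := Finset.HasAntidiagonal.mem_antidiagonal.mp hd
    dsimp only at h5
    refine hd' ⟨s, ?_, ?_⟩
    · rw [Finset.mem_coe, Finsupp.mem_support_iff, ← h5, Finsupp.add_apply]
      have : d s ≠ 0 := hs
      omega
    · rw [Prod.mk.injEq]
      refine ⟨h2, ?_⟩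
      rw [← h5, h2, add_tsub_cancel_left]
  · intro s _
    have h1 : MvPowerSeries.coeff (Finsupp.single s 1) (linearSymb c) =
        if (Finsupp.single s 1).degree = 1 then ∑ s ∈ (Finsupp.single s 1).support, c s else 0 :=
      rfl
    dsimp only
    rw [h1, Finsupp.degree_single, if_pos rfl, Finsupp.support_single _ one_ne_zero,
      Finset.sum_singleton]

/-- The degree of the letters `tₙ` and `∂/∂tₙ`. -/
def letterWeight : ℕ+ ⊕ ℕ+ → ℤ := Sum.elim (fun n => (n : ℕ)) (fun n => -((n : ℕ) : ℤ))

/-- The scalars in front of the letters in `J(z; -1)`. -/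
def letterCoeff : ℕ+ ⊕ ℕ+ → ℂ := Sum.elim (fun n => oddWeight n) (fun _ => 1)

theorem J_eq : J (-1) = linearSymb fun s =>
    LaurentPolynomial.C (letterCoeff s) * LaurentPolynomial.T (letterWeight s - 1) := by
  rw [J]
  congr 1
  funext s
  rcases s with n | n
  · rfl
  · simp [letterCoeff, letterWeight]

/-- The expression `(∂_z + J(z; -1))^k · 1`. -/
def symbPow (k : ℕ) : Symb := (fun F => dz F + J (-1) * F)^[k] 1

/-- The coefficient of `e z^j` in `(∂_z + J(z; -1))^k · 1`. -/
def symbCoeff (k : ℕ) (e : ℕ+ ⊕ ℕ+ →₀ ℕ) (j : ℤ) : ℂ :=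
  (MvPowerSeries.coeff e (symbPow k)).coeff j

theorem symbCoeff_zero (e : ℕ+ ⊕ ℕ+ →₀ ℕ) (j : ℤ) :
    symbCoeff 0 e j = if e = 0 ∧ j = 0 then 1 else 0 := by
  classical
  have h1 : (1 : ℂ[T;T⁻¹]).coeff j = if j = 0 then 1 else 0 := by
    rw [← map_one LaurentPolynomial.C, LaurentPolynomial.C_apply]
  rw [symbCoeff, symbPow, Function.iterate_zero, id, MvPowerSeries.coeff_one]
  by_cases he : e = 0
  · simp [he, h1]
  · simp [he]

theorem symbCoeff_succ (k : ℕ) (e : ℕ+ ⊕ ℕ+ →₀ ℕ) (j : ℤ) :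
    symbCoeff (k + 1) e j = ((j : ℂ) + 1) * symbCoeff k e (j + 1) +
      ∑ s ∈ e.support, letterCoeff s *
        symbCoeff k (e - Finsupp.single s 1) (j + 1 - letterWeight s) := by
  have h1 : MvPowerSeries.coeff e (dz (symbPow k)) =
      laurentDeriv (MvPowerSeries.coeff e (symbPow k)) := rfl
  rw [symbCoeff, symbPow, Function.iterate_succ_apply', ← symbPow, map_add, J_eq,
    coeff_linearSymb_mul, AddMonoidAlgebra.coeff_add, Finsupp.add_apply, h1, coeff_laurentDeriv,
    AddMonoidAlgebra.coeff_sum, Finset.sum_apply']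
  simp only [coeff_C_mul_T_mul]
  congr 1
  refine Finset.sum_congr rfl fun s _ => ?_
  rw [symbCoeff, sub_sub_eq_add_sub]

/-- Since ∂_z 1 = 0, the iteration can start from 1 one step earlier, which gives inductions on k
the trivial base k = 0. -/
theorem PSymb_eq (k : ℕ) (hk : 1 ≤ k) : PSymb (-1) k = symbPow k := by
  obtain ⟨k, rfl⟩ := Nat.exists_eq_add_of_le' hk
  rw [PSymb, symbPow, Nat.add_sub_cancel, Function.iterate_succ_apply]
  congr 1
  have h : dz 1 = 0 := by
    classical
    ext e j
    have h1 : MvPowerSeries.coeff e (dz 1) = laurentDeriv (MvPowerSeries.coeff e 1) := rfl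
    rw [h1, coeff_laurentDeriv, MvPowerSeries.coeff_one, map_zero]
    by_cases he : e = 0
    · rw [if_pos he, ← map_one LaurentPolynomial.C, LaurentPolynomial.C_apply]
      by_cases hj : j + 1 = 0
      · have : (j : ℂ) + 1 = 0 := by exact_mod_cast hj
        simp [this]
      · simp [hj]
    · simp [he]
  rw [h, zero_add, mul_one]

/-- Homogeneity: ∂_z lowers the exponent of z by one, and a letter s in J carries z to the power
`letterWeight s - 1`. Hence a bound on β bounds α, and the normally ordered sums are finite on each
polynomial. -/
theorem weight_of_symbCoeff_ne_zero (k : ℕ) (e : ℕ+ ⊕ ℕ+ →₀ ℕ) (j : ℤ)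
    (h : symbCoeff k e j ≠ 0) : Finsupp.weight letterWeight e = j + k := by
  induction k generalizing e j with
  | zero =>
    rw [symbCoeff_zero] at h
    obtain ⟨rfl, rfl⟩ : e = 0 ∧ j = 0 := by
      by_contra h'
      exact h (if_neg h')
    simp
  | succ k ih =>
    rw [symbCoeff_succ] at h
    by_cases h1 : symbCoeff k e (j + 1) = 0
    · rw [h1, mul_zero, zero_add] at h
      obtain ⟨s, hs, h2⟩ := Finset.exists_ne_zero_of_sum_ne_zero h
      have h3 := ih _ _ (right_ne_zero_of_mul h2)
      rw [← exists_eq_add_single (Finsupp.mem_support_iff.mp hs), map_add, h3,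
        Finsupp.weight_single, one_smul]
      push_cast
      ring
    · rw [ih _ _ h1]
      push_cast
      ring

theorem weight_sumElim (α β : ℕ+ →₀ ℕ) :
    Finsupp.weight letterWeight (Finsupp.sumElim α β) = (wt α : ℤ) - wt β := by
  rw [Finsupp.weight_apply, Finsupp.sum_sumElim, wt, Finsupp.weight_apply, Finsupp.weight_apply,
    Finsupp.sum, Finsupp.sum, Finsupp.sum, Finsupp.sum, sub_eq_add_neg]
  push_cast
  rw [← Finset.sum_neg_distrib]
  simp [letterWeight]

/-! ### The operators `P^{(k)}_m` recursively -/

theorem finsum_eq_finsum_comp {α β M : Type*} [AddCommMonoid M] {g : α → β}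
    (hg : Function.Injective g) (F : β → M) (hF : ∀ b, b ∉ Set.range g → F b = 0) :
    ∑ᶠ b, F b = ∑ᶠ a, F (g a) := by
  rw [← finsum_mem_range hg, finsum_mem_def]
  refine finsum_congr fun b => ?_
  by_cases hb : b ∈ Set.range g
  · rw [Set.indicator_of_mem hb]
  · rw [Set.indicator_of_notMem hb, hF b hb]

theorem hasFiniteSupport_of_comp {α β M : Type*} [AddCommMonoid M] {g : α → β} (F : β → M)
    (hF : ∀ b, b ∉ Set.range g → F b = 0) (h : Function.HasFiniteSupport fun a => F (g a)) :
    Function.HasFiniteSupport F := by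
  refine Set.Finite.subset (Set.Finite.image g h) fun b hb => ?_
  by_cases hb' : b ∈ Set.range g
  · obtain ⟨a, rfl⟩ := hb'
    exact ⟨a, hb, rfl⟩
  · exact absurd (hF b hb') hb

/-- The term of `t^α ∂^β` in the coefficient of `z^j` in `:(∂_z + J)^k · 1:` acting on `f`. -/
def symbTerm (k : ℕ) (j : ℤ) (f : Poly) (p : (ℕ+ →₀ ℕ) × (ℕ+ →₀ ℕ)) : Poly :=
  symbCoeff k (Finsupp.sumElim p.1 p.2) j •
    (MvPolynomial.monomial p.1 (1 : ℂ) * partialPow p.2 f)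

/-- The coefficient of `z^j` in `:(∂_z + J)^k · 1:`. -/
def symbOp (k : ℕ) (j : ℤ) (f : Poly) : Poly := ∑ᶠ p, symbTerm k j f p

theorem P_eq_symbOp (k : ℕ) (hk : 1 ≤ k) (m : ℤ) (f : Poly) :
    P (-1) k m f = symbOp k (-m - k) f := by
  rw [P, PSymb_eq k hk]
  rfl

theorem symbTerm_hasFiniteSupport (k : ℕ) (j : ℤ) (f : Poly) :
    Function.HasFiniteSupport (symbTerm k j f) := by
  obtain ⟨N, hN⟩ := exists_wt_bound f
  refine Set.Finite.subset ((finite_wt_le (j + k + N).toNat).prod (finite_wt_le N)) ?_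
  rintro ⟨α, β⟩ h
  have h1 : symbCoeff k (Finsupp.sumElim α β) j ≠ 0 := fun h0 => h (by simp [symbTerm, h0])
  have h2 : partialPow β f ≠ 0 := fun h0 => h (by simp [symbTerm, h0])
  have h3 := weight_of_symbCoeff_ne_zero _ _ _ h1
  rw [weight_sumElim] at h3
  have h4 := hN β h2
  exact ⟨show wt α ≤ _ by omega, h4⟩

theorem symbOp_zero (j : ℤ) (f : Poly) : symbOp 0 j f = if j = 0 then f else 0 := by
  rw [symbOp, finsum_eq_single _ (0, 0)]
  · rw [symbTerm, symbCoeff_zero, Finsupp.sumElim_zero_zero, partialPow_zero,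
      Module.End.one_apply]
    by_cases hj : j = 0
    · simp [hj]
    · simp [hj]
  · rintro ⟨α, β⟩ h
    rw [symbTerm, symbCoeff_zero, if_neg, zero_smul]
    rintro ⟨h1, -⟩
    refine h (Prod.ext ?_ ?_)
    · ext n
      have := DFunLike.congr_fun h1 (Sum.inl n)
      simpa using this
    · ext n
      have := DFunLike.congr_fun h1 (Sum.inr n)
      simpa using this

theorem sum_support_eq_sum_range {M : Type*} [AddCommMonoid M] (α : ℕ+ →₀ ℕ) (L : ℕ)
    (h : ∀ n, α n ≠ 0 → (n : ℕ) ≤ L) (g : ℕ+ → M) :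
    ∑ n ∈ α.support, g n =
      ∑ i ∈ Finset.range L, if α i.succPNat ≠ 0 then g i.succPNat else 0 := by
  rw [← Finset.sum_filter]
  refine Finset.sum_nbij' PNat.natPred Nat.succPNat ?_ ?_ ?_ ?_ ?_
  · intro n hn
    have hn := Finsupp.mem_support_iff.mp hn
    rw [Finset.mem_filter, PNat.succPNat_natPred, Finset.mem_range]
    have := h n hn
    have := n.natPred_add_one
    exact ⟨by omega, hn⟩
  · intro i hi
    exact Finsupp.mem_support_iff.mpr (Finset.mem_filter.mp hi).2
  · intro n _
    exact PNat.succPNat_natPred n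
  · intro i _
    exact Nat.natPred_succPNat i
  · intro n _
    rw [PNat.succPNat_natPred]

theorem sumElim_sub_inl (α β : ℕ+ →₀ ℕ) (n : ℕ+) :
    Finsupp.sumElim α β - Finsupp.single (Sum.inl n) 1 =
      Finsupp.sumElim (α - Finsupp.single n 1) β := by
  ext (i | i)
  · simp [Finsupp.single_apply]
  · simp

theorem sumElim_sub_inr (α β : ℕ+ →₀ ℕ) (n : ℕ+) :
    Finsupp.sumElim α β - Finsupp.single (Sum.inr n) 1 =
      Finsupp.sumElim α (β - Finsupp.single n 1) := by
  ext (i | i)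
  · simp
  · simp [Finsupp.single_apply]

theorem sum_support_sumElim {M : Type*} [AddCommMonoid M] (α β : ℕ+ →₀ ℕ)
    (g : ℕ+ ⊕ ℕ+ → M) : ∑ s ∈ (Finsupp.sumElim α β).support, g s =
      ∑ n ∈ α.support, g (Sum.inl n) + ∑ n ∈ β.support, g (Sum.inr n) :=
  Finsupp.sum_sumElim (f₁ := α) (f₂ := β) (g := fun s _ => g s)

/-- The part of `symbTerm (k + 1) j f` coming from the letter `tₙ`, `n = i + 1`, of `J`. -/
def multTerm (k : ℕ) (j : ℤ) (f : Poly) (i : ℕ) (p : (ℕ+ →₀ ℕ) × (ℕ+ →₀ ℕ)) : Poly :=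
  if p.1 i.succPNat ≠ 0 then
    (oddWeight (i + 1) *
      symbCoeff k (Finsupp.sumElim (p.1 - Finsupp.single i.succPNat 1) p.2) (j + 1 - (i + 1))) •
      (MvPolynomial.monomial p.1 (1 : ℂ) * partialPow p.2 f)
  else 0

/-- The part of `symbTerm (k + 1) j f` coming from the letter `∂/∂tₙ`, `n = i + 1`, of `J`. -/
def derivTerm (k : ℕ) (j : ℤ) (f : Poly) (i : ℕ) (p : (ℕ+ →₀ ℕ) × (ℕ+ →₀ ℕ)) : Poly :=
  if p.2 i.succPNat ≠ 0 then
    symbCoeff k (Finsupp.sumElim p.1 (p.2 - Finsupp.single i.succPNat 1)) (j + 1 + (i + 1)) •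
      (MvPolynomial.monomial p.1 (1 : ℂ) * partialPow p.2 f)
  else 0

theorem multTerm_shift (k : ℕ) (j : ℤ) (f : Poly) (i : ℕ) (p : (ℕ+ →₀ ℕ) × (ℕ+ →₀ ℕ)) :
    multTerm k j f i (p.1 + Finsupp.single i.succPNat 1, p.2) =
      (oddWeight (i + 1) • (MvPolynomial.X i.succPNat : Poly)) *
        symbTerm k (j + 1 - (i + 1)) f p := by
  have h1 : (p.1 + Finsupp.single i.succPNat 1 : ℕ+ →₀ ℕ) i.succPNat ≠ 0 := by simp
  have h2 : MvPolynomial.monomial (p.1 + Finsupp.single i.succPNat 1) (1 : ℂ) =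
      MvPolynomial.monomial p.1 1 * (MvPolynomial.X i.succPNat : Poly) := by
    rw [MvPolynomial.X, MvPolynomial.monomial_mul, mul_one]
  rw [multTerm, if_pos h1, symbTerm, add_tsub_cancel_right, h2, mul_smul, smul_mul_assoc,
    mul_smul_comm, mul_left_comm, ← mul_assoc]

theorem derivTerm_shift (k : ℕ) (j : ℤ) (f : Poly) (i : ℕ) (p : (ℕ+ →₀ ℕ) × (ℕ+ →₀ ℕ)) :
    derivTerm k j f i (p.1, p.2 + Finsupp.single i.succPNat 1) =
      symbTerm k (j + 1 + (i + 1)) (partialT i.succPNat f) p := by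
  have h1 : (p.2 + Finsupp.single i.succPNat 1 : ℕ+ →₀ ℕ) i.succPNat ≠ 0 := by simp
  rw [derivTerm, if_pos h1, symbTerm, add_tsub_cancel_right, partialPow_add_single]

theorem multTerm_eq_zero (k : ℕ) (j : ℤ) (f : Poly) (i : ℕ) (p : (ℕ+ →₀ ℕ) × (ℕ+ →₀ ℕ))
    (hp : p ∉ Set.range fun p : (ℕ+ →₀ ℕ) × (ℕ+ →₀ ℕ) =>
      (p.1 + Finsupp.single i.succPNat 1, p.2)) : multTerm k j f i p = 0 := by
  rw [multTerm, if_neg]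
  exact fun h => hp ⟨(p.1 - Finsupp.single i.succPNat 1, p.2),
    Prod.ext (exists_eq_add_single h) rfl⟩

theorem derivTerm_eq_zero (k : ℕ) (j : ℤ) (f : Poly) (i : ℕ) (p : (ℕ+ →₀ ℕ) × (ℕ+ →₀ ℕ))
    (hp : p ∉ Set.range fun p : (ℕ+ →₀ ℕ) × (ℕ+ →₀ ℕ) =>
      (p.1, p.2 + Finsupp.single i.succPNat 1)) : derivTerm k j f i p = 0 := by
  rw [derivTerm, if_neg]
  exact fun h => hp ⟨(p.1, p.2 - Finsupp.single i.succPNat 1),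
    Prod.ext rfl (exists_eq_add_single h)⟩

theorem finsum_multTerm (k : ℕ) (j : ℤ) (f : Poly) (i : ℕ) :
    Function.HasFiniteSupport (multTerm k j f i) ∧ ∑ᶠ p, multTerm k j f i p =
      (oddWeight (i + 1) • (MvPolynomial.X i.succPNat : Poly)) *
        symbOp k (j + 1 - (i + 1)) f := by
  have h := symbTerm_hasFiniteSupport k (j + 1 - (i + 1)) f
  constructor
  · refine hasFiniteSupport_of_comp _ (multTerm_eq_zero k j f i) ?_
    simp only [multTerm_shift]
    exact Set.Finite.subset h (Function.support_mul_subset_right _ _)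
  · rw [finsum_eq_finsum_comp ?_ _ (multTerm_eq_zero k j f i)]
    · simp only [multTerm_shift]
      rw [symbOp, mul_finsum' _ _ h]
    · intro p q hpq
      have hpq := Prod.ext_iff.mp hpq
      exact Prod.ext (add_right_cancel hpq.1) hpq.2

theorem finsum_derivTerm (k : ℕ) (j : ℤ) (f : Poly) (i : ℕ) :
    Function.HasFiniteSupport (derivTerm k j f i) ∧ ∑ᶠ p, derivTerm k j f i p =
      symbOp k (j + 1 + (i + 1)) (partialT i.succPNat f) := by
  constructor
  · refine hasFiniteSupport_of_comp _ (derivTerm_eq_zero k j f i) ?_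
    simp only [derivTerm_shift]
    exact symbTerm_hasFiniteSupport _ _ _
  · rw [finsum_eq_finsum_comp ?_ _ (derivTerm_eq_zero k j f i)]
    · simp only [derivTerm_shift]
      rfl
    · intro p q hpq
      have hpq := Prod.ext_iff.mp hpq
      exact Prod.ext hpq.1 (add_right_cancel hpq.2)

theorem symbTerm_succ (k : ℕ) (j : ℤ) (f : Poly) (N : ℕ)
    (hN : ∀ β, partialPow β f ≠ 0 → wt β ≤ N) (L : ℕ) (hL : j + 1 + k + N ≤ L) (hL' : N ≤ L)
    (p : (ℕ+ →₀ ℕ) × (ℕ+ →₀ ℕ)) :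
    symbTerm (k + 1) j f p = ((j : ℂ) + 1) • symbTerm k (j + 1) f p +
      (∑ i ∈ Finset.range L, multTerm k j f i p +
        ∑ i ∈ Finset.range L, derivTerm k j f i p) := by
  obtain ⟨α, β⟩ := p
  by_cases hβ : partialPow β f = 0
  · simp [symbTerm, multTerm, derivTerm, hβ]
  have hβN := hN β hβ
  have h1 : ∑ n ∈ β.support, letterCoeff (Sum.inr n) * symbCoeff k
      (Finsupp.sumElim α β - Finsupp.single (Sum.inr n) 1) (j + 1 - letterWeight (Sum.inr n)) =
      ∑ i ∈ Finset.range L, if β i.succPNat ≠ 0 then symbCoeff k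
        (Finsupp.sumElim α (β - Finsupp.single i.succPNat 1)) (j + 1 + (i + 1)) else 0 := by
    rw [sum_support_eq_sum_range β L fun n hn => (le_wt hn).trans (hβN.trans hL')]
    refine Finset.sum_congr rfl fun i _ => if_congr Iff.rfl ?_ rfl
    rw [sumElim_sub_inr, letterCoeff, letterWeight, Sum.elim_inr, Sum.elim_inr, one_mul,
      sub_neg_eq_add, Nat.succPNat_coe]
    push_cast
    rfl
  have h2 : ∑ n ∈ α.support, letterCoeff (Sum.inl n) * symbCoeff k
      (Finsupp.sumElim α β - Finsupp.single (Sum.inl n) 1) (j + 1 - letterWeight (Sum.inl n)) =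
      ∑ i ∈ Finset.range L, if α i.succPNat ≠ 0 then oddWeight (i + 1) * symbCoeff k
        (Finsupp.sumElim (α - Finsupp.single i.succPNat 1) β) (j + 1 - (i + 1)) else 0 := by
    have h3 : ∀ n : ℕ+, letterCoeff (Sum.inl n) * symbCoeff k
        (Finsupp.sumElim α β - Finsupp.single (Sum.inl n) 1)
          (j + 1 - letterWeight (Sum.inl n)) =
        oddWeight n * symbCoeff k
          (Finsupp.sumElim (α - Finsupp.single n 1) β) (j + 1 - (n : ℕ)) := by
      intro n
      rw [sumElim_sub_inl, letterCoeff, letterWeight, Sum.elim_inl, Sum.elim_inl]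
    -- By homogeneity a nonzero coefficient forces wt α = j + 1 + k + wt β, which is at most L.
    have h4 : ∀ n : ℕ+, α n ≠ 0 → L < wt α → symbCoeff k
          (Finsupp.sumElim (α - Finsupp.single n 1) β) (j + 1 - (n : ℕ)) = 0 := by
      intro n hn hα
      by_contra h5
      have h6 := weight_of_symbCoeff_ne_zero _ _ _ h5
      have h7 := congrArg wt (exists_eq_add_single hn)
      rw [map_add, Finsupp.weight_single, one_smul] at h7
      rw [weight_sumElim] at h6
      omega
    simp only [h3]
    rcases le_or_gt (wt α) L with hα | hα
    · rw [sum_support_eq_sum_range α L fun n hn => (le_wt hn).trans hα]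
      refine Finset.sum_congr rfl fun i _ => if_congr Iff.rfl ?_ rfl
      rw [Nat.succPNat_coe]
      push_cast
      rfl
    · rw [Finset.sum_eq_zero fun n hn => by
        rw [h4 n (Finsupp.mem_support_iff.mp hn) hα, mul_zero]]
      symm
      refine Finset.sum_eq_zero fun i _ => ?_
      split_ifs with hi
      · have := h4 _ hi hα
        rw [Nat.succPNat_coe] at this
        push_cast at this
        rw [this, mul_zero]
      · rfl
  rw [symbTerm, symbCoeff_succ, sum_support_sumElim, h1, h2, add_smul, add_smul, mul_smul,
    Finset.sum_smul, Finset.sum_smul, symbTerm]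
  simp only [ite_smul, zero_smul]
  rfl

/-- Inside the colons a new letter tₙ goes to the far left and a new ∂/∂tₙ to the far right, so the
symbol recursion becomes a recursion of operators. All sufficiently large L are admitted so that it
can be combined with other cutoffs. -/
theorem symbOp_succ (k : ℕ) (j : ℤ) (f : Poly) : ∃ L₀ : ℕ, ∀ L, L₀ ≤ L →
    symbOp (k + 1) j f = ((j : ℂ) + 1) • symbOp k (j + 1) f +
      (∑ i ∈ Finset.range L, (oddWeight (i + 1) • (MvPolynomial.X i.succPNat : Poly)) *
        symbOp k (j + 1 - (i + 1)) f +
      ∑ i ∈ Finset.range L, symbOp k (j + 1 + (i + 1)) (partialT i.succPNat f)) := by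
  obtain ⟨N, hN⟩ := exists_wt_bound f
  refine ⟨(j + 1 + k + N).toNat + N, fun L hL => ?_⟩
  have h0 := symbTerm_hasFiniteSupport k (j + 1) f
  have h1 : Function.HasFiniteSupport fun p => ((j : ℂ) + 1) • symbTerm k (j + 1) f p :=
    Set.Finite.subset h0 fun p hp h => hp (by beta_reduce; rw [h, smul_zero])
  have hfin : ∀ F : ℕ → (ℕ+ →₀ ℕ) × (ℕ+ →₀ ℕ) → Poly,
      (∀ i, Function.HasFiniteSupport (F i)) →
      Function.HasFiniteSupport fun p => ∑ i ∈ Finset.range L, F i p := fun F hF => by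
    refine Set.Finite.subset (Set.Finite.biUnion (Finset.range L).finite_toSet
      fun i _ => hF i) fun p hp => ?_
    obtain ⟨i, hi, h⟩ := Finset.exists_ne_zero_of_sum_ne_zero hp
    exact Set.mem_biUnion hi h
  have h2 := hfin _ fun i => (finsum_multTerm k j f i).1
  have h3 := hfin _ fun i => (finsum_derivTerm k j f i).1
  rw [symbOp, finsum_congr (symbTerm_succ k j f N hN L (by omega) (by omega)),
    finsum_add_distrib h1 (Set.Finite.subset (h2.union h3) (Function.support_add _ _)),
    finsum_add_distrib h2 h3, ← smul_finsum' _ h0,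
    finsum_sum_comm _ _ fun i _ => (finsum_multTerm k j f i).1,
    finsum_sum_comm _ _ fun i _ => (finsum_derivTerm k j f i).1]
  simp only [(finsum_multTerm k j f _).2, (finsum_derivTerm k j f _).2]
  rfl

/-! ### Descending factorials and the numbers `d_k(n)` -/

/-- The descending factorial `n (n - 1) ⋯ (n - k + 1)`. -/
def descFac (n : ℤ) (k : ℕ) : ℂ := ∏ i ∈ Finset.range k, ((n : ℂ) - (i : ℂ))

theorem descFac_succ (n : ℤ) (k : ℕ) : descFac n (k + 1) = descFac n k * ((n : ℂ) - k) :=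
  Finset.prod_range_succ _ _

theorem descFac_add_one_succ (n : ℤ) (k : ℕ) :
    descFac (n + 1) (k + 1) = ((n : ℂ) + 1) * descFac n k := by
  rw [descFac, Finset.prod_range_succ', mul_comm, descFac]
  congr 1
  · push_cast
    ring
  · refine Finset.prod_congr rfl fun i _ => ?_
    push_cast
    ring

theorem descFac_zero_left {k : ℕ} (hk : 1 ≤ k) : descFac 0 k = 0 :=
  Finset.prod_eq_zero (Finset.mem_range.mpr hk) (by simp)

theorem intBinom_eq (n : ℤ) (j : ℕ) : intBinom n j = descFac n j / (j.factorial : ℂ) := rfl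

theorem intBinom_add_one_succ (n : ℤ) (j : ℕ) :
    intBinom (n + 1) (j + 1) = intBinom n (j + 1) + intBinom n j := by
  have h1 : (j.factorial : ℂ) ≠ 0 := by exact_mod_cast j.factorial_ne_zero
  have h2 : (j : ℂ) + 1 ≠ 0 := by exact_mod_cast j.succ_ne_zero
  rw [intBinom_eq, intBinom_eq, intBinom_eq, descFac_add_one_succ, descFac_succ,
    Nat.factorial_succ]
  push_cast
  field_simp
  ring

/-- Pascal's rule telescopes the truncated sums and leaves only the top term. -/
theorem sum_intBinom_add (n : ℤ) (k : ℕ) :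
    ∑ j ∈ Finset.range (k + 1), (-2 : ℂ) ^ j * intBinom n j +
      ∑ j ∈ Finset.range (k + 1), (-2 : ℂ) ^ j * intBinom (n + 1) j =
      2 * (-2) ^ k * intBinom n k := by
  induction k with
  | zero => norm_num [intBinom]
  | succ k ih =>
    rw [Finset.sum_range_succ, Finset.sum_range_succ _ (k + 1), intBinom_add_one_succ]
    linear_combination ih

/-- The difference equation characterising d_k up to an alternating constant; the prefactor of d_k
normalises its right side, which equals k n(n-1)⋯(n-k+2). -/
theorem dCoeff_add (k : ℕ) (hk : 1 ≤ k) (n : ℤ) :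
    dCoeff k n + dCoeff k (n + 1) = descFac (n + 1) k - descFac n k := by
  obtain ⟨k, rfl⟩ := Nat.exists_eq_add_of_le' hk
  have h1 : (k.factorial : ℂ) ≠ 0 := by exact_mod_cast k.factorial_ne_zero
  have h2 : ((-1 : ℂ) ^ k / 2 ^ (k + 1)) * (2 * (-2) ^ k) = 1 := by
    have h3 : (-2 : ℂ) ^ k = (-1) ^ k * 2 ^ k := by rw [← mul_pow]; norm_num
    have h4 : (-1 : ℂ) ^ k * (-1) ^ k = 1 := by rw [← mul_pow]; norm_num
    rw [h3]
    field_simp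
    linear_combination (2 * 2 ^ k : ℂ) * h4
  rw [dCoeff, dCoeff, ← mul_add, sum_intBinom_add, Nat.add_sub_cancel, mul_assoc, ← mul_assoc _
    (2 * (-2 : ℂ) ^ k), h2, descFac_add_one_succ, descFac_succ, intBinom_eq, Nat.factorial_succ]
  push_cast
  field_simp
  ring

/-- The vacuum expectation value of `(-1)^a B_a B_{-a}`. -/
def vac (a : ℤ) : ℂ := if a < 0 then 2 else if a = 0 then 1 else 0

theorem vac_sub_one (a : ℤ) :
    vac (a - 1) = vac a + ((if a = 0 then 1 else 0) + (if a = 1 then 1 else 0)) := by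
  unfold vac
  split_ifs <;> first | omega | norm_num

theorem neg_one_zpow_mul_contraction (a j : ℤ) :
    (-1 : ℂ) ^ a * contraction (j - a) = (-1) ^ j * vac (a - j) := by
  rcases lt_trichotomy j a with h | h | h
  · rw [contraction_of_neg (by omega), vac, if_neg (by omega), if_neg (by omega), mul_zero,
      mul_zero]
  · subst h
    rw [sub_self, contraction_zero, vac, if_neg (lt_irrefl _), if_pos rfl]
  · rw [contraction_of_pos (by omega), vac, if_pos (by omega), mul_left_comm,
      ← zpow_add₀ (by norm_num), add_sub_cancel, mul_comm]

theorem sum_dCoeff_vac_succ (k M : ℕ) (j : ℤ) (h1 : -(M : ℤ) ≤ j) (h2 : j + 1 ≤ M) :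
    ∑ a ∈ Finset.Icc (-(M : ℤ)) M, dCoeff k a * vac (a - (j + 1)) =
      ∑ a ∈ Finset.Icc (-(M : ℤ)) M, dCoeff k a * vac (a - j) +
        (dCoeff k j + dCoeff k (j + 1)) := by
  have h : ∀ a : ℤ, dCoeff k a * vac (a - (j + 1)) = dCoeff k a * vac (a - j) +
      ((if a = j then dCoeff k a else 0) + (if a = j + 1 then dCoeff k a else 0)) := by
    intro a
    have e1 : a - (j + 1) = a - j - 1 := by ring
    have e2 : (a - j = 0) ↔ a = j := by omega
    have e3 : (a - j = 1) ↔ a = j + 1 := by omega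
    rw [e1, vac_sub_one, mul_add, mul_add]
    simp only [e2, e3, mul_ite, mul_one, mul_zero]
  simp only [h]
  rw [Finset.sum_add_distrib, Finset.sum_add_distrib, Finset.sum_ite_eq', Finset.sum_ite_eq',
    if_pos (Finset.mem_Icc.mpr ⟨h1, by omega⟩), if_pos (Finset.mem_Icc.mpr ⟨by omega, h2⟩)]

/-- Raising j by one adds d_k(j) + d_k(j+1) to the left side, because `vac` drops from 2 to 1 to 0.
By `dCoeff_add` both sides have equal increments, and both vanish at j = 0 because k ≥ 1. -/
theorem sum_dCoeff_vac (k : ℕ) (hk : 1 ≤ k) (M : ℕ) (j : ℤ)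
    (hj : j ∈ Finset.Icc (-(M : ℤ)) M) :
    ∑ a ∈ Finset.Icc (-(M : ℤ)) M, dCoeff k a * (vac (a - j) - vac a) = descFac j k := by
  simp only [mul_sub]
  rw [Finset.sum_sub_distrib, sub_eq_iff_eq_add]
  have h0 : ∑ a ∈ Finset.Icc (-(M : ℤ)) M, dCoeff k a * vac (a - 0) =
      descFac 0 k + ∑ a ∈ Finset.Icc (-(M : ℤ)) M, dCoeff k a * vac a := by
    simp [descFac_zero_left hk]
  have hj := Finset.mem_Icc.mp hj
  induction j using Int.induction_on with
  | zero => exact h0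
  | succ i ih =>
    have h := ih (Finset.mem_Icc.mpr ⟨by omega, by omega⟩) ⟨by omega, by omega⟩
    rw [sum_dCoeff_vac_succ k M i (by omega) (by omega), h, dCoeff_add k hk]
    ring
  | pred i ih =>
    have h := ih (Finset.mem_Icc.mpr ⟨by omega, by omega⟩) ⟨by omega, by omega⟩
    have h1 := sum_dCoeff_vac_succ k M (-i - 1) (by omega) (by omega)
    rw [sub_add_cancel, h] at h1
    have h2 := dCoeff_add k hk (-i - 1)
    rw [sub_add_cancel] at h2
    linear_combination -h1 - h2

/-! ### The operators `P^{(k)}_m` in terms of normally ordered products -/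

/-- The coefficient of `z^{-m-k}` in `∂_w^k :B(w) B(-z):` at `w = z`. -/
def fermionSum (k : ℕ) (m : ℤ) (f : Poly) : Poly :=
  ∑ᶠ a : ℤ, (descFac a k * (-1) ^ (m + a)) • normalOp a (-m - a) f

theorem fermionSum_eq {f : Poly} {K : ℕ} (hK : ∀ q : ℤ, K ≤ q → shiftOp q f = 0) (k : ℕ) (m : ℤ)
    (M : ℕ) (hM : K + |m| ≤ M) :
    fermionSum k m f = ∑ a ∈ Finset.Icc (-(M : ℤ)) M,
      (descFac a k * (-1) ^ (m + a)) • normalOp a (-m - a) f := by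
  have hm := abs_le.mp (le_refl |m|)
  refine finsum_eq_sum_of_support_subset _ fun a ha => ?_
  rw [Finset.coe_Icc, Set.mem_Icc]
  by_contra h
  refine ha ?_
  beta_reduce
  rcases lt_or_ge a (-(M : ℤ)) with h1 | h1
  · rw [normalOp_of_left_neg hK _ (by omega), smul_zero]
  · rw [normalOp_of_right_neg hK _ (by omega), smul_zero]

theorem sum_normalOp {f : Poly} (hf : IsOdd f) {K : ℕ}
    (hK : ∀ q : ℤ, K ≤ q → shiftOp q f = 0) (m : ℤ) (M : ℕ) (hM : K + |m| ≤ M) :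
    ∑ a ∈ Finset.Icc (-(M : ℤ)) M, ((-1 : ℂ) ^ (m + a)) • normalOp a (-m - a) f =
      if m = 0 then f else 0 := by
  have h := alternating_sum_normalOp hK hf (-m) M (by rwa [abs_neg])
  have hne : (-1 : ℂ) ≠ 0 := by norm_num
  simp only [zpow_add₀ hne, mul_smul]
  rw [← Finset.smul_sum, h]
  rcases eq_or_ne m 0 with rfl | hm
  · simp
  · simp [hm]

/-- On odd polynomials ∂_z B(-z) = -J(z)B(-z) under normal ordering: odd letters change the
alternating sign, and even letters contribute nothing. -/
theorem mul_normalOp_of_isOdd {f : Poly} (hf : IsOdd f) {K : ℕ}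
    (hK : ∀ q : ℤ, K ≤ q → shiftOp q f = 0) (hd : ∀ n : ℕ, K ≤ n → partialT n.succPNat f = 0)
    (m a : ℤ) (L : ℕ) (hL : 3 * K + |m| ≤ L) (c : ℂ) :
    (c * (-1) ^ (m + a) * ((-m - a : ℤ) : ℂ)) • normalOp a (-m - a) f =
      -(∑ i ∈ Finset.range L, (oddWeight (i + 1) • (MvPolynomial.X i.succPNat : Poly)) *
        ((c * (-1) ^ (m + (i + 1) + a)) • normalOp a (-(m + (i + 1)) - a) f) +
      ∑ i ∈ Finset.range L, (c * (-1) ^ (m - (i + 1) + a)) •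
        normalOp a (-(m - (i + 1)) - a) (partialT i.succPNat f)) := by
  have hm := abs_le.mp (le_refl |m|)
  have hne : (-1 : ℂ) ≠ 0 := by norm_num
  -- If a > -K, the second index -m-a is below |m| + K, hence the cutoff 3K + |m|; if a ≤ -K, every
  -- normally ordered product is zero.
  rcases lt_or_ge (-(K : ℤ)) a with ha | ha
  · rw [mul_smul, mul_normalOp hK hd a (-m - a) L (by omega) (by omega), smul_add,
      Finset.smul_sum, Finset.smul_sum, neg_add, ← Finset.sum_neg_distrib,
      ← Finset.sum_neg_distrib]
    congr 1
    · refine Finset.sum_congr rfl fun i _ => ?_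
      have e1 : -m - a - ((i : ℤ) + 1) = -(m + (i + 1)) - a := by ring
      rcases Nat.even_or_odd (i + 1) with hi | hi
      · simp [oddWeight, hi.neg_one_pow]
      · have e2 : (-1 : ℂ) ^ (m + ((i : ℤ) + 1) + a) = -(-1) ^ (m + a) := by
          have h3 : m + ((i : ℤ) + 1) + a = m + a + ((i + 1 : ℕ) : ℤ) := by push_cast; ring
          rw [h3, zpow_add₀ hne _ ((i + 1 : ℕ) : ℤ), zpow_natCast, hi.neg_one_pow, mul_neg_one]
        rw [e1, e2, mul_smul_comm, mul_neg, neg_smul, neg_neg]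
    · refine Finset.sum_congr rfl fun i _ => ?_
      have e1 : -m - a + ((i : ℤ) + 1) = -(m - (i + 1)) - a := by ring
      rcases Nat.even_or_odd (i + 1) with hi | hi
      · rw [hf i hi]
        have h0 : ∀ b, normalOp a b 0 = 0 := fun b => by simp [normalOp]
        rw [h0, h0, smul_zero, smul_zero, neg_zero]
      · have e2 : (-1 : ℂ) ^ (m - ((i : ℤ) + 1) + a) = -(-1) ^ (m + a) := by
          have h3 : m + a = m - ((i : ℤ) + 1) + a + ((i + 1 : ℕ) : ℤ) := by push_cast; ring
          rw [h3, zpow_add₀ hne _ ((i + 1 : ℕ) : ℤ), zpow_natCast, hi.neg_one_pow, mul_neg_one, neg_neg]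
        rw [e1, e2, mul_neg, neg_smul, neg_neg]
  · have h0 : ∀ n, ∀ q : ℤ, K ≤ q → shiftOp q (partialT n f) = 0 := fun n q hq => by
      rw [shiftOp_partialT, hK q hq, map_zero]
    rw [normalOp_of_left_neg hK _ (by omega), smul_zero, eq_comm, neg_eq_zero]
    rw [Finset.sum_eq_zero, Finset.sum_eq_zero, add_zero]
    · intro i _
      rw [normalOp_of_left_neg (h0 _) _ (by omega), smul_zero]
    · intro i _
      rw [normalOp_of_left_neg hK _ (by omega), smul_zero, mul_zero]

/-- Let F_k be ∂_w^k :B(w)B(-z): at w = z. By the product rule ∂_z F_k = F_{k+1} - J F_k, which is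
the recursion of (∂_z + J)^k · 1. In coefficients, (-m-k) - (-m-a) = a - k is the next factor of the
descending factorial. -/
theorem symbOp_eq_fermionSum (k : ℕ) {f : Poly} (hf : IsOdd f) (m : ℤ) :
    symbOp k (-m - k) f = fermionSum k m f := by
  induction k generalizing f m with
  | zero =>
    obtain ⟨K, hK⟩ := exists_shiftOp_eq_zero f
    obtain ⟨M, hM⟩ : ∃ M : ℕ, (M : ℤ) = K + |m| := ⟨_, Int.toNat_of_nonneg (by positivity)⟩
    rw [symbOp_zero, fermionSum_eq hK 0 m M hM.ge]
    simp only [descFac, Finset.range_zero, Finset.prod_empty, one_mul]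
    rw [sum_normalOp hf hK m M hM.ge]
    refine if_congr ?_ rfl rfl
    omega
  | succ k ih =>
    obtain ⟨K₁, hK₁⟩ := exists_shiftOp_eq_zero f
    obtain ⟨K₂, hK₂⟩ := exists_partialT_eq_zero f
    obtain ⟨L₀, hL₀⟩ := symbOp_succ k (-m - (k + 1 : ℕ)) f
    obtain ⟨K, h1, h2⟩ : ∃ K : ℕ, K₁ ≤ K ∧ K₂ ≤ K := ⟨max K₁ K₂, le_max_left _ _, le_max_right _ _⟩
    have hK : ∀ q : ℤ, K ≤ q → shiftOp q f = 0 := fun q hq => hK₁ q (by omega)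
    have hd : ∀ n : ℕ, K ≤ n → partialT n.succPNat f = 0 := fun n hn => hK₂ n (by omega)
    have hK' : ∀ n, ∀ q : ℤ, K ≤ q → shiftOp q (partialT n f) = 0 := fun n q hq => by
      rw [shiftOp_partialT, hK q hq, map_zero]
    obtain ⟨A, hA⟩ : ∃ A : ℕ, (A : ℤ) = |m| := ⟨_, Int.natCast_natAbs m⟩
    have hm := abs_le.mp hA.ge
    obtain ⟨L, hL1, hL2⟩ : ∃ L : ℕ, L₀ ≤ L ∧ 3 * K + A ≤ L :=
      ⟨max L₀ (3 * K + A), le_max_left _ _, le_max_right _ _⟩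
    -- One window that holds the support for m and for all shifted modes m ± (i + 1) with i < L.
    obtain ⟨M, hM⟩ : ∃ M : ℕ, M = K + A + L + 1 := ⟨_, rfl⟩
    have e1 : -m - ((k + 1 : ℕ) : ℤ) + 1 = -m - k := by push_cast; ring
    have e2 : (((-m - ((k + 1 : ℕ) : ℤ) : ℤ) : ℂ) + 1) = -m - k := by push_cast; ring
    have e3 : ∀ i : ℕ, -m - (k : ℤ) - (i + 1) = -(m + (i + 1)) - k := fun i => by ring
    have e4 : ∀ i : ℕ, -m - (k : ℤ) + (i + 1) = -(m - (i + 1)) - k := fun i => by ring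
    rw [hL₀ L hL1, e1, e2, ih hf]
    simp only [e3, e4, ih hf, fun n => ih (hf.partialT n)]
    rw [fermionSum_eq hK _ m M (by omega), fermionSum_eq hK _ m M (by omega), Finset.smul_sum]
    have e5 : ∀ i ∈ Finset.range L,
        (oddWeight (i + 1) • (MvPolynomial.X i.succPNat : Poly)) * fermionSum k (m + (i + 1)) f =
        ∑ a ∈ Finset.Icc (-(M : ℤ)) M, (oddWeight (i + 1) • (MvPolynomial.X i.succPNat : Poly)) *
          ((descFac a k * (-1) ^ (m + (i + 1) + a)) • normalOp a (-(m + (i + 1)) - a) f) := by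
      intro i hi
      have hi := Finset.mem_range.mp hi
      rw [fermionSum_eq hK _ _ M ?_, Finset.mul_sum]
      have : |m + ((i : ℤ) + 1)| ≤ A + (i + 1) := abs_le.mpr ⟨by omega, by omega⟩
      omega
    have e6 : ∀ i ∈ Finset.range L,
        fermionSum k (m - (i + 1)) (partialT i.succPNat f) =
        ∑ a ∈ Finset.Icc (-(M : ℤ)) M, (descFac a k * (-1) ^ (m - (i + 1) + a)) •
          normalOp a (-(m - (i + 1)) - a) (partialT i.succPNat f) := by
      intro i hi
      have hi := Finset.mem_range.mp hi
      refine fermionSum_eq (hK' _) _ _ M ?_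
      have : |m - ((i : ℤ) + 1)| ≤ A + (i + 1) := abs_le.mpr ⟨by omega, by omega⟩
      omega
    rw [Finset.sum_congr rfl e5, Finset.sum_congr rfl e6, Finset.sum_comm,
      Finset.sum_comm (s := Finset.range L), ← Finset.sum_add_distrib, ← Finset.sum_add_distrib]
    refine Finset.sum_congr rfl fun a _ => ?_
    have e7 := mul_normalOp_of_isOdd hf hK hd m a L (by omega) (descFac a k)
    rw [← neg_eq_iff_eq_neg] at e7
    rw [← e7, smul_smul, ← neg_smul, ← add_smul, descFac_succ]
    congr 1
    push_cast
    ring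

/-- Bosonization: `P^{(k)}_m` as a quadratic expression in the neutral fermions. -/
theorem P_eq_sum_vertexOp (k : ℕ) (hk : 1 ≤ k) (m : ℤ) {f : Poly} (hf : IsOdd f) :
    ∃ M₀ : ℕ, ∀ M : ℕ, M₀ ≤ M → P (-1) k m f = ∑ a ∈ Finset.Icc (-(M : ℤ)) M, dCoeff k a •
      ((-1 : ℂ) ^ (m + a) • vertexOp a (vertexOp (-m - a) f) -
        vac a • if m = 0 then f else 0) := by
  obtain ⟨K, hK⟩ := exists_shiftOp_eq_zero f
  refine ⟨K + m.natAbs, fun M hM => ?_⟩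
  have hM' : K + |m| ≤ M := by
    rw [← Int.natCast_natAbs]
    exact_mod_cast hM
  have hm := abs_le.mp (le_refl |m|)
  have hne : (-1 : ℂ) ≠ 0 := by norm_num
  -- The scalar term is also rewritten as a sum of normally ordered products, so that coefficients
  -- can be compared index by index.
  rw [P_eq_symbOp k hk, symbOp_eq_fermionSum k hf, fermionSum_eq hK k m M hM',
    ← sum_normalOp hf hK m M hM']
  have e1 : ∀ a ∈ Finset.Icc (-(M : ℤ)) M, dCoeff k a •
      ((-1 : ℂ) ^ (m + a) • vertexOp a (vertexOp (-m - a) f) - vac a •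
        ∑ a ∈ Finset.Icc (-(M : ℤ)) M, ((-1 : ℂ) ^ (m + a)) • normalOp a (-m - a) f) =
      ∑ j ∈ Finset.Icc (-(M : ℤ)) M, (dCoeff k a * (vac (a - j) - vac a)) •
        ((-1 : ℂ) ^ (m + j) • normalOp j (-m - j) f) := by
    intro a ha
    have ha := Finset.mem_Icc.mp ha
    rw [vertexOp_vertexOp_left hK a (-m) M ha.1 (by omega), Finset.smul_sum, Finset.smul_sum,
      ← Finset.sum_sub_distrib, Finset.smul_sum]
    refine Finset.sum_congr rfl fun j _ => ?_
    have e2 : (-1 : ℂ) ^ (m + a) * contraction (j - a) = vac (a - j) * (-1) ^ (m + j) := by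
      rw [zpow_add₀ hne, mul_assoc, neg_one_zpow_mul_contraction, zpow_add₀ hne]
      ring
    rw [smul_smul, e2, mul_smul, ← sub_smul, smul_smul]
  rw [Finset.sum_congr rfl e1, Finset.sum_comm]
  refine Finset.sum_congr rfl fun j hj => ?_
  rw [← Finset.sum_smul, sum_dCoeff_vac k hk M j hj, smul_smul]

/-! ### The action on Q-functions -/

/-- Two uses of the Clifford relations commute B_n past B_a B_{-m-a}. They contribute only at a = n
- m and a = -n, which are the two terms of `cCoeff`; the vacuum term is scalar and drops out. -/
theorem P_vertexOp (k : ℕ) (hk : 1 ≤ k) (m n : ℤ) {f : Poly} (hf : IsOdd f) :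
    P (-1) k m (vertexOp n f) =
      cCoeff k m n • vertexOp (n - m) f + vertexOp n (P (-1) k m f) := by
  obtain ⟨M₁, h1⟩ := P_eq_sum_vertexOp k hk m hf
  obtain ⟨M₂, h2⟩ := P_eq_sum_vertexOp k hk m (hf.vertexOp n)
  -- The last bound puts both a = n - m and a = -n inside the window.
  obtain ⟨M, hM1, hM2, hM3⟩ : ∃ M : ℕ, M₁ ≤ M ∧ M₂ ≤ M ∧ n.natAbs + m.natAbs ≤ M :=
    ⟨M₁ + M₂ + (n.natAbs + m.natAbs), by omega, by omega, by omega⟩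
  have hne : (-1 : ℂ) ≠ 0 := by norm_num
  have hsq : ∀ i : ℤ, (-1 : ℂ) ^ i * (-1) ^ i = 1 := fun i => by
    rw [← mul_zpow]
    norm_num
  rw [h1 M hM1, h2 M hM2, map_sum, ← sub_eq_iff_eq_add, ← Finset.sum_sub_distrib]
  have e1 : ∀ a ∈ Finset.Icc (-(M : ℤ)) M,
      dCoeff k a • ((-1 : ℂ) ^ (m + a) • vertexOp a (vertexOp (-m - a) (vertexOp n f)) -
        vac a • if m = 0 then vertexOp n f else 0) -
      vertexOp n (dCoeff k a • ((-1 : ℂ) ^ (m + a) • vertexOp a (vertexOp (-m - a) f) -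
        vac a • if m = 0 then f else 0)) =
      (if a = n - m then (2 * dCoeff k (n - m)) • vertexOp (n - m) f else 0) -
      (if a = -n then (2 * (-1) ^ m * dCoeff k (-n)) • vertexOp (n - m) f else 0) := by
    intro a _
    have c1 := vertexOp_anticommute hf (-m - a) n
    have c2 := vertexOp_anticommute (hf.vertexOp (-m - a)) a n
    have c3 : vertexOp n (if m = 0 then f else 0) = if m = 0 then vertexOp n f else 0 := by
      rw [apply_ite (vertexOp n), map_zero]
    rw [map_smul, map_sub, map_smul, map_smul, c3, ← smul_sub, sub_sub_sub_cancel_right,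
      ← smul_sub, eq_sub_of_add_eq c1, eq_sub_of_add_eq' c2, map_sub, sub_sub_sub_comm,
      sub_self, sub_zero, smul_sub, smul_sub]
    congr 1
    · by_cases h : a = n - m
      · subst h
        have h3 : -m - (n - m) = -n := by ring
        have h4 : m + (n - m) = n := by ring
        rw [if_pos rfl, h3, if_pos (by ring), map_smul, smul_smul, smul_smul, h4, zpow_neg,
          ← inv_zpow, inv_neg_one]
        congr 1
        linear_combination (2 * dCoeff k (n - m)) * hsq n
      · rw [if_neg h, if_neg (by omega), map_zero, smul_zero, smul_zero]
    · by_cases h : a = -n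
      · subst h
        have h3 : -m - -n = n - m := by ring
        rw [if_pos rfl, if_pos (by ring), h3, smul_smul, smul_smul, zpow_add₀ hne]
        congr 1
        linear_combination (2 * (-1) ^ m * dCoeff k (-n)) * hsq (-n)
      · rw [if_neg h, if_neg (by omega), smul_zero, smul_zero]
  rw [Finset.sum_congr rfl e1, Finset.sum_sub_distrib, Finset.sum_ite_eq', Finset.sum_ite_eq',
    if_pos (Finset.mem_Icc.mpr ⟨by omega, by omega⟩),
    if_pos (Finset.mem_Icc.mpr ⟨by omega, by omega⟩), ← sub_smul, cCoeff]

theorem vertexOp_one_of_neg {n : ℤ} (hn : n < 0) : vertexOp n 1 = 0 := by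
  refine vertexOp_of_neg (K := 1) (fun q hq => ?_) (by push_cast; omega)
  lift q to ℕ using by omega
  refine eq_of_natCast_smul (n := q) (by omega) ?_
  have := smul_shiftOp_apply q q le_rfl (1 : Poly)
  rw [Int.cast_natCast] at this
  rw [this, smul_zero, neg_eq_zero]
  refine Finset.sum_eq_zero fun i _ => ?_
  have : partialT i.succPNat (1 : Poly) = 0 := MvPolynomial.pderiv_one
  rw [this, map_zero]

theorem P_one (k : ℕ) (hk : 1 ≤ k) (m : ℤ) :
    P (-1) k m 1 = if m < 0 then ∑ a ∈ Finset.Icc (0 : ℤ) (-m),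
      ((-1 : ℂ) ^ (m - a) * dCoeff k a) • vertexOp a (vertexOp (-m - a) 1) else 0 := by
  obtain ⟨M₀, h⟩ := P_eq_sum_vertexOp k hk m isOdd_one
  have hne : (-1 : ℂ) ≠ 0 := by norm_num
  have hsq : ∀ i : ℤ, (-1 : ℂ) ^ i * (-1) ^ i = 1 := fun i => by
    rw [← mul_zpow]
    norm_num
  -- Outside 0 ≤ a ≤ -m one of the two modes annihilates 1. For m = 0 the remaining constants,
  -- including B_0 B_0 · 1 = 1, cancel against `vac`.
  have h0 : ∀ a : ℤ, ¬(m < 0 ∧ 0 ≤ a ∧ a ≤ -m) →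
      ((-1 : ℂ) ^ (m + a) • vertexOp a (vertexOp (-m - a) 1) -
        vac a • if m = 0 then (1 : Poly) else 0) = 0 := by
    intro a ha
    have c := vertexOp_anticommute isOdd_one a (-m - a)
    rcases lt_trichotomy a 0 with h1 | h1 | h1
    · rw [vertexOp_one_of_neg h1, map_zero, add_zero] at c
      rw [c, vac, if_pos h1]
      rcases eq_or_ne m 0 with rfl | hm
      · rw [if_pos (by ring), if_pos rfl, smul_smul, zero_add, mul_left_comm, hsq, mul_one,
          sub_self]
      · rw [if_neg (by omega), if_neg hm, smul_zero, smul_zero, sub_zero]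
    · subst h1
      rcases eq_or_ne m 0 with rfl | hm
      · have h2 : vertexOp 0 (vertexOp 0 (1 : Poly)) = 1 := by
          rw [neg_zero, sub_zero, if_pos (add_zero _), zpow_zero, mul_one, ← two_smul ℂ] at c
          exact smul_right_injective Poly (two_ne_zero (α := ℂ)) c
        rw [neg_zero, sub_zero, h2, vac]
        simp
      · rw [vertexOp_one_of_neg (n := -m - 0) (by omega), map_zero, if_neg hm, smul_zero,
          smul_zero, sub_zero]
    · rw [vertexOp_one_of_neg (n := -m - a) (by omega), vac, if_neg (by omega),
        if_neg (by omega), map_zero, smul_zero, zero_smul, sub_zero]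
  rw [h (M₀ + m.natAbs) (by omega)]
  by_cases hm : m < 0
  · rw [if_pos hm, ← Finset.sum_subset (s₁ := Finset.Icc (0 : ℤ) (-m))]
    · refine Finset.sum_congr rfl fun a _ => ?_
      rw [if_neg hm.ne, smul_zero, sub_zero, smul_smul, mul_comm, zpow_add₀ hne, zpow_sub₀ hne,
        div_eq_mul_inv, ← inv_zpow, inv_neg_one]
    · refine Finset.Icc_subset_Icc (by omega) (by omega)
    · intro a _ ha
      rw [h0 a fun h' => ha (Finset.mem_Icc.mpr h'.2), smul_zero]
  · rw [if_neg hm]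
    refine Finset.sum_eq_zero fun a _ => ?_
    rw [h0 a fun h' => hm h'.1, smul_zero]

theorem schurQ_succ {l : ℕ} (lam : Fin (l + 1) → ℤ) :
    schurQ lam = vertexOp (lam 0) (schurQ (Fin.tail lam)) := by
  rw [schurQ, hallLittlewood, List.ofFn_succ, List.foldr_cons]
  rfl

theorem schurQ_append {l n : ℕ} (lam : Fin l → ℤ) (mu : Fin n → ℤ) :
    schurQ (Fin.append lam mu) = (List.ofFn lam).foldr (B (-1)) (schurQ mu) := by
  rw [schurQ, hallLittlewood, List.ofFn_fin_append, List.foldr_append]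
  rfl

theorem isOdd_schurQ {l : ℕ} (lam : Fin l → ℤ) : IsOdd (schurQ lam) := by
  induction l with
  | zero => exact isOdd_one
  | succ l ih =>
    rw [schurQ_succ]
    exact (ih _).vertexOp _

theorem schurQ_append_succ {l n : ℕ} (lam : Fin (l + 1) → ℤ) (mu : Fin n → ℤ) :
    schurQ (Fin.append lam mu) = vertexOp (lam 0) (schurQ (Fin.append (Fin.tail lam) mu)) := by
  rw [schurQ_append, List.ofFn_succ, List.foldr_cons, schurQ_append]
  rfl

end WTypeQ

end

theorem theorem1p1 (k : ℕ) (hk : 1 ≤ k) (m : ℤ) (l : ℕ) (lam : Fin l → ℤ) :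
    WTypeQ.P (-1) k m (WTypeQ.schurQ lam) =
      ∑ i : Fin l, WTypeQ.cCoeff k m (lam i) •
        WTypeQ.schurQ (Function.update lam i (lam i - m)) +
      (if m < 0 then
        ∑ a ∈ Finset.Icc (0 : ℤ) (-m), ((-1 : ℂ) ^ (m - a) * WTypeQ.dCoeff k a) •
          WTypeQ.schurQ (Fin.append lam ![a, -m - a])
      else 0) := by
  induction l with
  | zero =>
    rw [Finset.univ_eq_empty, Finset.sum_empty, zero_add]
    exact WTypeQ.P_one k hk m
  | succ l ih =>
    -- Commuting past the first vertex operator produces the summand i = 0; that operator applied to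
    -- the induction hypothesis gives all the others.
    rw [WTypeQ.schurQ_succ, WTypeQ.P_vertexOp k hk m _ (WTypeQ.isOdd_schurQ _), ih, map_add,
      ← add_assoc, Fin.sum_univ_succ]
    congr 1
    · congr 1
      · rw [WTypeQ.schurQ_succ, Function.update_self, Fin.tail_update_zero]
      · rw [map_sum]
        refine Finset.sum_congr rfl fun i _ => ?_
        rw [map_smul, WTypeQ.schurQ_succ (Function.update lam i.succ _), Fin.tail_update_succ,
          Function.update_of_ne (Fin.succ_ne_zero i).symm]
        rfl
    · rw [apply_ite (WTypeQ.vertexOp (lam 0)), map_zero, map_sum]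
      simp only [map_smul, WTypeQ.schurQ_append_succ]
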